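/- Let $\mathbb{R}\ni x\mapsto W(x)$ be a two-sided standard Brownian motion with continuous paths, and let $B=(B_s)_{s\ge 0}$ be a standard Brownian motion with law $\mathbf P$ (expectation $\mathbf E$). For a continuous function $w:\mathbb{R}\to\mathbb{R}$ (an environment) put $A_w(x)=\int_0^x e^{w(y)}\,dy$. Suppose that $A_w$ maps $\mathbb{R}$ onto $\mathbb{R}$. For a continuous path $b:[0,\infty)\to\mathbb{R}$ put $$T_w(u,b)=\int_0^u e^{-2w(A_w^{-1}(b(s)))}\,ds ,\qquad X^{w}_t(b)=A_w^{-1}\bigl(b(T_w^{-1}(t,b))\bigr),\qquad t\ge 0,$$ where $T_w^{-1}(\cdot,b)$ is the inverse of $T_w(\cdot,b)$. The process $X^w(A_w(x)+B)$ is the diffusion in the fixed environment $w$, formally with generator $\frac12 e^{w}\frac{d}{dx}\bigl(e^{-w}\frac{d}{dx}\bigr)$, started at $x$. Its semigroup is $$H^{w}_tf(x)=\mathbf E\bigl[f(X_t)\mid X_0=x\bigr]=\mathbf E\bigl[f\bigl(X^{w}_t(A_w(x)+B)\bigr)\bigr],\qquad f\in C_0,$$ where $C_0$ is the space of continuous functions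 $f:\mathbb{R}\to\mathbb{R}$ that vanish as $|x|\to\infty$. For $w=W$ frozen this is the (quenched) Brox diffusion. Then for almost every trajectory of $W$ the following holds. If $(W_n)_{n\ge1}$ is any sequence of continuous functions $\mathbb{R}\to\mathbb{R}$ (for instance, piecewise differentiable ones) such that each $A_{W_n}$ maps $\mathbb{R}$ onto $\mathbb{R}$ and $W_n\to W$ uniformly on compact sets, then for every $t\ge 0$ and every $f\in C_0$ $$\sup_{x\in\mathbb{R}}\bigl|H^{W_n}_tf(x)-H^{W}_tf(x)\bigr|\longrightarrow 0,\qquad n\to\infty .$$ -/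

import Mathlib

open MeasureTheory ProbabilityTheory Filter Topology
open scoped NNReal ENNReal ZeroAtInfty

namespace Brox

/-- A random element `W` of `C(ℝ)` is a two-sided standard Brownian motion: `(W(x))` and
`(W(-x))`, `x ≥ 0`, are two independent standard Brownian motions. -/
structure IsTwoSidedBrownian {Ω : Type*} [MeasurableSpace Ω] (W : Ω → C(ℝ, ℝ))
    (μ : Measure Ω) : Prop where
  right : IsBrownianReal (fun (x : ℝ≥0) ω => W ω (x : ℝ)) μ
  left : IsBrownianReal (fun (x : ℝ≥0) ω => W ω (-(x : ℝ))) μ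
  indep : IndepFun (fun ω (x : ℝ≥0) => W ω (x : ℝ)) (fun ω (x : ℝ≥0) => W ω (-(x : ℝ))) μ

/-- The scale function `A(x) = ∫₀ˣ e^{w(y)} dy` of the environment `w`. -/
noncomputable def scale (w : C(ℝ, ℝ)) (x : ℝ) : ℝ :=
  ∫ y in (0 : ℝ)..x, Real.exp (w y)

/-- The inverse `A⁻¹` of the scale function. As `A` is strictly increasing, this is a genuine
two-sided inverse as soon as `A` is onto. -/
noncomputable def scaleInv (w : C(ℝ, ℝ)) : ℝ → ℝ :=
  Function.invFun (scale w)

/-- The clock `T(u, b) = ∫₀ᵘ e^{-2 w(A⁻¹(b(s)))} ds` along a path `b`. -/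
noncomputable def clock (w : C(ℝ, ℝ)) (b : ℝ≥0 → ℝ) (u : ℝ≥0) : ℝ :=
  ∫ s in (0 : ℝ)..(u : ℝ), Real.exp (-2 * w (scaleInv w (b s.toNNReal)))

/-- The inverse clock `T⁻¹(t, b)`, the first time at which the clock reaches `t`. For a continuous
path `b`, with `A` onto, the clock is continuous and strictly increasing, so that this is its
inverse wherever it has one. -/
noncomputable def clockInv (w : C(ℝ, ℝ)) (b : ℝ≥0 → ℝ) (t : ℝ≥0) : ℝ≥0 :=
  sInf {u : ℝ≥0 | (t : ℝ) ≤ clock w b u}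

/-- The path `X_t = A⁻¹(b(T⁻¹(t, b)))` of the diffusion in the environment `w` driven by the
path `b`. It starts at `A⁻¹(b(0))`. -/
noncomputable def path (w : C(ℝ, ℝ)) (b : ℝ≥0 → ℝ) (t : ℝ≥0) : ℝ :=
  scaleInv w (b (clockInv w b t))

/-- The quenched semigroup `H_t f (x) = E[f(X_t) | X_0 = x]` of the diffusion in the fixed
environment `w`. Under `X_0 = x` the diffusion is driven by the Brownian motion `A(x) + B`
started at `A(x)`, where `B` is a standard Brownian motion under `ν`. -/
noncomputable def semigroup {Ω : Type*} [MeasurableSpace Ω] (ν : Measure Ω)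
    (B : ℝ≥0 → Ω → ℝ) (w : C(ℝ, ℝ)) (t : ℝ≥0) (f : C₀(ℝ, ℝ)) (x : ℝ) : ℝ :=
  ∫ ω, f (path w (fun s => scale w x + B s ω) t) ∂ν

/-- The supremum norm of a real function, with values in `[0, ∞]`. -/
noncomputable def supNorm (g : ℝ → ℝ) : ℝ≥0∞ :=
  ⨆ x, ‖g x‖ₑ

end Brox

namespace Brox

/-! ### Continuity of scale, clock and path in the environment and the driving path. -/

section Deterministic

/-! One Brownian motion `B` drives the diffusions in all environments. For locally uniform
convergence of environments with onto scale, the inverse scale and the clock are continuous in all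
variables, and so is the path at time `t` wherever the clock exceeds `t` (`continuousAt_path`). If
the clock of `W` almost surely exceeds every time, dominated convergence makes the semigroup jointly
continuous in environment and starting point at `(W, x)`, hence uniformly convergent for `x` in
compact sets. What remains is this non-explosion, and the smallness of `H_t f(x)` for large `|x|`,
uniformly over environments near `W`.

Both come from long flat intervals. Let `w` oscillate by at most `c` on `[L - ℓ, L + ℓ]`. To get
from `L` to the edge, the driving path must cover a distance of order `e^{w(L)} ℓ`, which by
Brownian scaling takes a time of order `e^{2w(L)} ℓ²`; meanwhile the clock runs at a rate of order
`e^{-2w(L)}`. The height `w(L)` cancels, so for `ℓ` large in terms of `t` and `c` alone the crossing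
is unlikely to be finished by time `t` (`exists_measure_cross_le`).

Almost every `W` has flat intervals of any length arbitrarily far out on both sides: a block is flat
with positive probability, and a zero-one law makes this happen infinitely often (`ae_flatOften`).
Those whose height is bounded below also force the scale to be onto. Only one compact interval on
each side is needed, so nearby environments inherit its flatness with a worse constant. A diffusion
started far away would have to cross one of these intervals to be near the origin at time `t`
(`exists_measure_path_le`), and an exploding one would have crossed one too fast
(`ae_exists_lt_clock`). -/

lemma hasDerivAt_scale (w : C(ℝ, ℝ)) (x : ℝ) : HasDerivAt (scale w) (Real.exp (w x)) x := by
  have hc : Continuous fun y => Real.exp (w y) := by fun_prop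
  exact intervalIntegral.integral_hasDerivAt_right (hc.intervalIntegrable _ _)
    (hc.stronglyMeasurableAtFilter _ _) hc.continuousAt

lemma continuous_scale_uncurry : Continuous fun p : C(ℝ, ℝ) × ℝ => scale p.1 p.2 := by
  unfold scale
  refine intervalIntegral.continuous_parametric_intervalIntegral_of_continuous ?_ continuous_snd
  fun_prop

lemma scale_strictMono (w : C(ℝ, ℝ)) : StrictMono (scale w) :=
  strictMono_of_hasDerivAt_pos (hasDerivAt_scale w) fun _ => Real.exp_pos _

lemma continuous_scale (w : C(ℝ, ℝ)) : Continuous (scale w) :=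
  continuous_scale_uncurry.comp (Continuous.prodMk_right w)

lemma scale_scaleInv {w : C(ℝ, ℝ)} (hw : Function.Surjective (scale w)) (y : ℝ) :
    scale w (scaleInv w y) = y :=
  Function.rightInverse_invFun hw y

lemma scaleInv_lt_iff {w : C(ℝ, ℝ)} (hw : Function.Surjective (scale w)) {x y : ℝ} :
    scaleInv w y < x ↔ y < scale w x := by
  rw [← (scale_strictMono w).lt_iff_lt, scale_scaleInv hw]

lemma lt_scaleInv_iff {w : C(ℝ, ℝ)} (hw : Function.Surjective (scale w)) {x y : ℝ} :
    x < scaleInv w y ↔ scale w x < y := by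
  rw [← (scale_strictMono w).lt_iff_lt, scale_scaleInv hw]

/-- The environments whose scale function is onto `ℝ`. -/
abbrev Env : Type := {w : C(ℝ, ℝ) // Function.Surjective (scale w)}

-- Comparing `scaleInv w y` with a fixed `x` amounts to comparing `y` with `scale w x`, so order
-- convergence reduces the claim to continuity of the scale at a fixed point.
@[fun_prop]
lemma continuous_scaleInv_uncurry : Continuous fun p : Env × ℝ => scaleInv p.1.1 p.2 := by
  have hs (x : ℝ) : Continuous fun p : Env × ℝ => scale p.1.1 x :=
    continuous_scale_uncurry.comp (by fun_prop : Continuous fun p : Env × ℝ => (p.1.1, x))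
  refine continuous_iff_continuousAt.2 fun p => tendsto_order.2 ⟨fun x hx => ?_, fun x hx => ?_⟩
  · rw [lt_scaleInv_iff p.1.2] at hx
    filter_upwards [(hs x).tendsto p |>.eventually_lt continuous_snd.continuousAt hx] with q hq
    rwa [lt_scaleInv_iff q.1.2]
  · rw [gt_iff_lt, scaleInv_lt_iff p.1.2] at hx
    filter_upwards [continuous_snd.continuousAt.eventually_lt ((hs x).tendsto p) hx] with q hq
    rwa [scaleInv_lt_iff q.1.2]

/-- The clock rate `e^{-2 w(A⁻¹(y))}` at the level `y`. -/
noncomputable def rate (w : C(ℝ, ℝ)) (y : ℝ) : ℝ := Real.exp (-2 * w (scaleInv w y))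

lemma continuous_rate_uncurry : Continuous fun p : Env × ℝ => rate p.1.1 p.2 := by
  unfold rate
  have h : Continuous fun p : Env × ℝ => p.1.1 (scaleInv p.1.1 p.2) :=
    continuous_eval.comp (f := fun p : Env × ℝ => (p.1.1, scaleInv p.1.1 p.2)) (by fun_prop)
  fun_prop

lemma continuous_rate (w : Env) : Continuous (rate w.1) :=
  continuous_rate_uncurry.comp (Continuous.prodMk_right w)

lemma clock_eq (w : C(ℝ, ℝ)) (b : ℝ≥0 → ℝ) (u : ℝ≥0) :
    clock w b u = ∫ s in (0 : ℝ)..(u : ℝ), rate w (b s.toNNReal) := rfl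

lemma continuous_clock_uncurry :
    Continuous fun p : (Env × C(ℝ≥0, ℝ)) × ℝ≥0 => clock p.1.1.1 p.1.2 p.2 := by
  simp only [clock_eq]
  refine intervalIntegral.continuous_parametric_intervalIntegral_of_continuous
    (f := fun (p : (Env × C(ℝ≥0, ℝ)) × ℝ≥0) s => rate p.1.1.1 (p.1.2 s.toNNReal)) ?_ (by fun_prop)
  have h : Continuous fun q : ((Env × C(ℝ≥0, ℝ)) × ℝ≥0) × ℝ => q.1.1.2 q.2.toNNReal :=
    continuous_eval.comp (f := fun q : ((Env × C(ℝ≥0, ℝ)) × ℝ≥0) × ℝ => (q.1.1.2, q.2.toNNReal))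
      (by fun_prop)
  exact continuous_rate_uncurry.comp (by fun_prop :
    Continuous fun q : ((Env × C(ℝ≥0, ℝ)) × ℝ≥0) × ℝ => (q.1.1.1, q.1.1.2 q.2.toNNReal))

lemma continuous_clock (w : Env) (b : C(ℝ≥0, ℝ)) : Continuous (clock w.1 b) :=
  continuous_clock_uncurry.comp (Continuous.prodMk_right (w, b))

lemma clock_zero (w : C(ℝ, ℝ)) (b : ℝ≥0 → ℝ) : clock w b 0 = 0 := by
  simp [clock]

lemma rate_intervalIntegrable (w : Env) (b : C(ℝ≥0, ℝ)) (x y : ℝ) :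
    IntervalIntegrable (fun s : ℝ => rate w.1 (b s.toNNReal)) volume x y := by
  have : Continuous fun s : ℝ => rate w.1 (b s.toNNReal) :=
    (continuous_rate w).comp (by fun_prop)
  exact this.intervalIntegrable _ _

lemma clock_sub (w : Env) (b : C(ℝ≥0, ℝ)) (u v : ℝ≥0) :
    clock w.1 b v - clock w.1 b u = ∫ s in (u : ℝ)..(v : ℝ), rate w.1 (b s.toNNReal) :=
  intervalIntegral.integral_interval_sub_left (rate_intervalIntegrable w b _ _)
    (rate_intervalIntegrable w b _ _)

lemma clock_strictMono (w : Env) (b : C(ℝ≥0, ℝ)) : StrictMono (clock w.1 b) := by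
  intro u v h
  rw [← sub_pos, clock_sub]
  exact intervalIntegral.intervalIntegral_pos_of_pos (rate_intervalIntegrable w b _ _)
    (fun s => Real.exp_pos _) (by exact_mod_cast h)

lemma le_clock_sub (w : Env) (b : C(ℝ≥0, ℝ)) {u v : ℝ≥0} (h : u ≤ v) {m : ℝ}
    (hm : ∀ s, u ≤ s → s ≤ v → m ≤ rate w.1 (b s)) :
    m * (v - u) ≤ clock w.1 b v - clock w.1 b u := by
  have h' : (u : ℝ) ≤ v := by exact_mod_cast h
  rw [clock_sub]
  calc m * (v - u) = ∫ s in (u : ℝ)..(v : ℝ), m := by simp [mul_comm]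
    _ ≤ _ := intervalIntegral.integral_mono_on h' (by simp) (rate_intervalIntegrable w b _ _) ?_
  intro s hs
  exact hm _ (by rw [← NNReal.coe_le_coe, Real.coe_toNNReal _ (u.2.trans hs.1)]; exact hs.1)
    (by rw [← NNReal.coe_le_coe, Real.coe_toNNReal _ (u.2.trans hs.1)]; exact hs.2)

lemma clockInv_le {w : C(ℝ, ℝ)} {b : ℝ≥0 → ℝ} {t u : ℝ≥0} (h : (t : ℝ) ≤ clock w b u) :
    clockInv w b t ≤ u :=
  csInf_le (s := {u : ℝ≥0 | (t : ℝ) ≤ clock w b u}) (OrderBot.bddBelow _) h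

lemma clockInv_lt {w : Env} {b : C(ℝ≥0, ℝ)} {t u : ℝ≥0} (h : (t : ℝ) < clock w.1 b u) :
    clockInv w.1 b t < u := by
  have hu : 0 < u := by
    rcases eq_or_ne u 0 with rfl | h0
    · rw [clock_zero] at h; exact absurd h (not_lt.2 t.2)
    · exact pos_iff_ne_zero.2 h0
  have h1 : ∀ᶠ v in 𝓝[<] u, (t : ℝ) < clock w.1 b v :=
    (((continuous_clock w b).tendsto u).eventually_const_lt h).filter_mono nhdsWithin_le_nhds
  have : (𝓝[<] u).NeBot := nhdsLT_neBot_of_exists_lt ⟨0, hu⟩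
  obtain ⟨v, hv, hvu⟩ := (h1.and self_mem_nhdsWithin).exists
  exact (clockInv_le hv.le).trans_lt hvu

/-- The hypothesis `h'` excludes the default value `sInf ∅ = 0`. -/
lemma le_clockInv {w : Env} {b : C(ℝ≥0, ℝ)} {t u u' : ℝ≥0} (h : clock w.1 b u < t)
    (h' : (t : ℝ) ≤ clock w.1 b u') : u ≤ clockInv w.1 b t := by
  refine le_csInf ⟨u', h'⟩ fun v hv => ?_
  exact ((clock_strictMono w b).lt_iff_lt.1 (h.trans_le hv)).le

/-- This survives explosion: if the clock never reaches `t`, then `clockInv` is `sInf ∅ = 0`. Hence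
the estimates far from the origin need no non-explosion for the nearby environments. -/
lemma clock_clockInv_le (w : Env) (b : C(ℝ≥0, ℝ)) (t : ℝ≥0) :
    clock w.1 b (clockInv w.1 b t) ≤ t := by
  by_contra! h
  exact lt_irrefl _ (clockInv_lt h)

/-- Strict monotonicity of the clock turns pointwise continuity in `(w, b)` into continuity of the
inverse; `h` persists nearby and keeps the infimum away from `sInf ∅`. -/
lemma continuousAt_clockInv {w : Env} {b : C(ℝ≥0, ℝ)} {t u : ℝ≥0}
    (h : (t : ℝ) < clock w.1 b u) :
    ContinuousAt (fun p : Env × C(ℝ≥0, ℝ) => clockInv p.1.1 p.2 t) (w, b) := by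
  have hc (v : ℝ≥0) : Continuous fun p : Env × C(ℝ≥0, ℝ) => clock p.1.1 p.2 v :=
    continuous_clock_uncurry.comp (by fun_prop : Continuous fun p : Env × C(ℝ≥0, ℝ) => (p, v))
  have hev : ∀ v, (t : ℝ) < clock w.1 b v →
      ∀ᶠ p : Env × C(ℝ≥0, ℝ) in 𝓝 (w, b), (t : ℝ) < clock p.1.1 p.2 v := fun v hv =>
    ((hc v).tendsto (w, b)).eventually_const_lt hv
  refine tendsto_order.2 ⟨fun v hv => ?_, fun v hv => ?_⟩
  · dsimp only at hv
    obtain ⟨v', hvv', hv'⟩ := exists_between hv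
    have h1 : clock w.1 b v' < t := by
      by_contra! h1
      exact absurd (clockInv_le h1) (not_le.2 hv')
    filter_upwards [((hc v').tendsto (w, b)).eventually_lt_const h1, hev u h] with p hp hp'
    exact hvv'.trans_le (le_clockInv hp hp'.le)
  · dsimp only at hv
    have h1 : (t : ℝ) < clock w.1 b v := by
      by_contra! h1
      have h2 : clockInv w.1 b t ∈ {u : ℝ≥0 | (t : ℝ) ≤ clock w.1 b u} :=
        (isClosed_le continuous_const (continuous_clock w b)).csInf_mem ⟨u, h.le⟩
          (OrderBot.bddBelow _)
      exact absurd (clock_strictMono w b hv) (not_lt.2 (h1.trans h2))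
    filter_upwards [hev v h1] with p hp
    exact clockInv_lt hp

/-- The path of the diffusion depends continuously on the environment and on the driving path. -/
lemma continuousAt_path {w : Env} {b : C(ℝ≥0, ℝ)} {t u : ℝ≥0} (h : (t : ℝ) < clock w.1 b u) :
    ContinuousAt (fun p : Env × C(ℝ≥0, ℝ) => path p.1.1 p.2 t) (w, b) := by
  have h1 : ContinuousAt (fun p : Env × C(ℝ≥0, ℝ) => p.2 (clockInv p.1.1 p.2 t)) (w, b) :=
    (continuous_eval (X := ℝ≥0) (Y := ℝ)).continuousAt.comp
      (continuousAt_snd.prodMk (continuousAt_clockInv h))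
  exact continuous_scaleInv_uncurry.continuousAt.comp (continuousAt_fst.prodMk h1)

/-- The second alternative is explosion before `t`, where `clockInv` defaults to `0`. Countably many
clock events occur, as needed in `measurable_path`. -/
lemma clockInv_le_iff (w : Env) (b : C(ℝ≥0, ℝ)) (t u : ℝ≥0) :
    clockInv w.1 b t ≤ u ↔ (t : ℝ) ≤ clock w.1 b u ∨ ∀ n : ℕ, clock w.1 b n < t := by
  constructor
  · intro h
    by_contra! h'
    obtain ⟨h1, n, hn⟩ := h'
    have h2 : clockInv w.1 b t ∈ {u : ℝ≥0 | (t : ℝ) ≤ clock w.1 b u} :=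
      (isClosed_le continuous_const (continuous_clock w b)).csInf_mem ⟨n, hn⟩
        (OrderBot.bddBelow _)
    exact absurd ((clock_strictMono w b).monotone h) (not_le.2 (h1.trans_le h2))
  · rintro (h | h)
    · exact clockInv_le h
    · have : {u : ℝ≥0 | (t : ℝ) ≤ clock w.1 b u} = ∅ := by
        ext v
        obtain ⟨n, hn⟩ := exists_nat_ge v
        simpa using ((clock_strictMono w b).monotone hn).trans_lt (h n)
      simp [clockInv, this]

end Deterministic

/-! ### Continuous version, scaling, Markov property at fixed times. -/

section Brownian

open TopologicalSpace (denseSeq denseRange_denseSeq)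

variable {Ω : Type*} {mΩ : MeasurableSpace Ω} {P : Measure Ω} {B B' : ℝ≥0 → Ω → ℝ}

/-- A Brownian motion all of whose paths are continuous and start at `0`, with measurable
coordinates. -/
structure IsContBrownian (B : ℝ≥0 → Ω → ℝ) (P : Measure Ω) : Prop
    extends IsPreBrownianReal B P where
  meas : ∀ t, Measurable (B t)
  cont : ∀ ω, Continuous (B · ω)
  zero : ∀ ω, B 0 ω = 0

lemma IsContBrownian.isProbabilityMeasure (hB : IsContBrownian B P) : IsProbabilityMeasure P :=
  hB.isGaussianProcess.isProbabilityMeasure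

lemma measurable_of_dense_of_continuous (hB : ∀ n, Measurable (B (denseSeq ℝ≥0 n)))
    (hc : ∀ ω, Continuous (B · ω)) (t : ℝ≥0) : Measurable (B t) := by
  have ht : t ∈ closure (Set.range (denseSeq ℝ≥0)) := denseRange_denseSeq ℝ≥0 t
  obtain ⟨x, hx, hxt⟩ := mem_closure_iff_seq_limit.1 ht
  refine measurable_of_tendsto_metrizable (f := fun k => B (x k)) (fun k => ?_)
    (tendsto_pi_nhds.2 fun ω => ((hc ω).tendsto t).comp hxt)
  obtain ⟨n, hn⟩ := hx k
  exact hn ▸ hB n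

/-- A Brownian motion is indistinguishable from one all of whose paths are continuous. -/
lemma exists_isContBrownian (hB : IsBrownianReal B P) :
    ∃ B' : ℝ≥0 → Ω → ℝ, IsContBrownian B' P ∧ ∀ᵐ ω ∂P, ∀ t, B' t ω = B t ω := by
  classical
  have hm (n : ℕ) := hB.aemeasurable (denseSeq ℝ≥0 n)
  have hae : ∀ᵐ ω ∂P, Continuous (B · ω) ∧ B 0 ω = 0 ∧
      ∀ n, B (denseSeq ℝ≥0 n) ω = (hm n).mk _ ω := by
    filter_upwards [hB.cont, hB.eval_zero_ae_eq_zero, ae_all_iff.2 fun n => (hm n).ae_eq_mk]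
      with ω h1 h2 h3 using ⟨h1, h2, h3⟩
  obtain ⟨N, hN, hNm, hN0⟩ := exists_measurable_superset_of_null (ae_iff.1 hae)
  have hgood : ∀ ω, ω ∉ N → Continuous (B · ω) ∧ B 0 ω = 0 ∧
      ∀ n, B (denseSeq ℝ≥0 n) ω = (hm n).mk _ ω := fun ω hω => by
    by_contra h
    exact hω (hN h)
  -- The paths are set to `0` on a measurable null set. Off it they agree with measurable versions
  -- at a dense set of times, which gives genuine measurability at all times.
  let C : ℝ≥0 → Ω → ℝ := fun t => Nᶜ.indicator (B t)
  have hC : ∀ᵐ ω ∂P, ∀ t, C t ω = B t ω := by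
    filter_upwards [measure_eq_zero_iff_ae_notMem.1 hN0] with ω hω t
    exact Set.indicator_of_mem (by simpa using hω) _
  have hcont : ∀ ω, Continuous (C · ω) := fun ω => by
    by_cases hω : ω ∈ N
    · simp only [C, Set.indicator_of_notMem (s := Nᶜ) (by simpa using hω : ω ∉ Nᶜ)]
      exact continuous_const
    · simp only [C, Set.indicator_of_mem (s := Nᶜ) (by simpa using hω : ω ∈ Nᶜ)]
      exact (hgood ω hω).1
  refine ⟨C, ⟨hB.toIsPreBrownianReal.congr fun t => ?_, ?_, hcont, fun ω => ?_⟩, hC⟩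
  · filter_upwards [hC] with ω h using (h t).symm
  · refine measurable_of_dense_of_continuous (fun n => ?_) hcont
    have : C (denseSeq ℝ≥0 n) = Nᶜ.indicator ((hm n).mk _) := by
      ext ω
      by_cases hω : ω ∈ N
      · simp [C, hω]
      · simp [C, hω, (hgood ω hω).2.2 n]
    rw [this]
    exact (hm n).measurable_mk.indicator hNm.compl
  · by_cases hω : ω ∈ N
    · simp [C, hω]
    · simp [C, hω, (hgood ω hω).2.1]

lemma IsContBrownian.neg (hB : IsContBrownian B P) : IsContBrownian (-B) P where
  toIsPreBrownianReal := hB.toIsPreBrownianReal.neg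
  meas t := (hB.meas t).neg
  cont ω := (hB.cont ω).neg
  zero ω := by simp [hB.zero ω]

lemma IsContBrownian.smul (hB : IsContBrownian B P) {c : ℝ≥0} (hc : c ≠ 0) :
    IsContBrownian (fun t ω => (√c)⁻¹ * B (c * t) ω) P where
  toIsPreBrownianReal := hB.toIsPreBrownianReal.smul hc
  meas t := (hB.meas _).const_mul _
  cont ω := by have := hB.cont ω; fun_prop
  zero ω := by simp [hB.zero ω]

lemma IsContBrownian.shift (hB : IsContBrownian B P) (u : ℝ≥0) :
    IsContBrownian (fun t ω => B (u + t) ω - B u ω) P where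
  toIsPreBrownianReal := hB.toIsPreBrownianReal.shift u
  meas t := (hB.meas _).sub (hB.meas _)
  cont ω := by have := hB.cont ω; fun_prop
  zero ω := by simp

/-- Brownian motions have the same law on path space. -/
lemma IsContBrownian.measure_eq (hB : IsContBrownian B P) (hB' : IsContBrownian B' P)
    {S : Set (ℝ≥0 → ℝ)} (hS : MeasurableSet S) :
    P {ω | (B · ω) ∈ S} = P {ω | (B' · ω) ∈ S} := by
  have := hB.isProbabilityMeasure
  have h1 : Measurable fun ω => (B · ω) := measurable_pi_lambda _ hB.meas
  have h2 : Measurable fun ω => (B' · ω) := measurable_pi_lambda _ hB'.meas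
  have h : P.map (fun ω => (B · ω)) = P.map (fun ω => (B' · ω)) := by
    rw [map_eq_iff_forall_finset_map_restrict_eq h1.aemeasurable h2.aemeasurable]
    intro I
    rw [(hB.hasLaw I).map_eq, (hB'.hasLaw I).map_eq]
  have := congrArg (fun Q => Q S) h
  rwa [Measure.map_apply h1 hS, Measure.map_apply h2 hS] at this

/-- The `σ`-algebra generated by the process up to time `u`. -/
@[reducible]
def past (B : ℝ≥0 → Ω → ℝ) (u : ℝ≥0) : MeasurableSpace Ω :=
  MeasurableSpace.comap (fun ω (t : Set.Iic u) => B t ω) inferInstance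

/-- The `σ`-algebra generated by the increments of the process after time `u`. -/
@[reducible]
def future (B : ℝ≥0 → Ω → ℝ) (u : ℝ≥0) : MeasurableSpace Ω :=
  MeasurableSpace.comap (fun ω t => B (u + t) ω - B u ω) inferInstance

lemma measurable_past {s u : ℝ≥0} (h : s ≤ u) : Measurable[past B u] (B s) :=
  (measurable_pi_apply (⟨s, h⟩ : Set.Iic u)).comp
    (comap_measurable fun ω (t : Set.Iic u) => B t ω)

lemma measurable_future (u t : ℝ≥0) : Measurable[future B u] fun ω => B (u + t) ω - B u ω :=
  (measurable_pi_apply t).comp (comap_measurable fun ω t => B (u + t) ω - B u ω)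

lemma past_le (hB : ∀ t, Measurable (B t)) (u : ℝ≥0) : past B u ≤ mΩ :=
  (measurable_pi_lambda _ fun t : Set.Iic u => hB t).comap_le

lemma future_le (hB : ∀ t, Measurable (B t)) (u : ℝ≥0) : future B u ≤ mΩ :=
  (measurable_pi_lambda _ fun t => (hB (u + t)).sub (hB u)).comap_le

lemma past_mono : Monotone (past B) := by
  intro u v h
  refine Measurable.comap_le (m₂ := inferInstance) ?_
  exact @measurable_pi_lambda _ _ _ (past B v) _ _ fun t => measurable_past (t.2.trans h)

lemma IsContBrownian.indep_future_past (hB : IsContBrownian B P) (u : ℝ≥0) :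
    Indep (future B u) (past B u) P :=
  hB.indepFun_shift u

lemma IsContBrownian.measure_inter (hB : IsContBrownian B P) (u : ℝ≥0) {F G : Set Ω}
    (hF : MeasurableSet[past B u] F) (hG : MeasurableSet[future B u] G) :
    P (F ∩ G) = P F * P G := by
  rw [Set.inter_comm, mul_comm]
  exact Indep_iff _ _ _ |>.1 (hB.indep_future_past u) _ _ hG hF

/-- The paths that exceed `r` in absolute value before time `a`. -/
def exceed (a : ℝ≥0) (r : ℝ) : Set (ℝ≥0 → ℝ) :=
  {x | ∃ n, denseSeq ℝ≥0 n < a ∧ r < |x (denseSeq ℝ≥0 n)|}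

lemma measurableSet_exceed (a : ℝ≥0) (r : ℝ) : MeasurableSet (exceed a r) := by
  have : exceed a r = ⋃ n, ⋃ _ : denseSeq ℝ≥0 n < a, {x | r < |x (denseSeq ℝ≥0 n)|} := by
    ext; simp [exceed]
  rw [this]
  exact .iUnion fun n => .iUnion fun _ => measurableSet_lt measurable_const
    (measurable_pi_apply _).abs

lemma mem_exceed {a : ℝ≥0} {r : ℝ} {x : ℝ≥0 → ℝ} (hx : Continuous x) :
    x ∈ exceed a r ↔ ∃ s < a, r < |x s| := by
  constructor
  · rintro ⟨n, h1, h2⟩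
    exact ⟨_, h1, h2⟩
  · rintro ⟨s, h1, h2⟩
    obtain ⟨n, hn⟩ := (denseRange_denseSeq ℝ≥0).exists_mem_open
      ((isOpen_lt continuous_id continuous_const).inter (isOpen_lt continuous_const hx.abs))
      ⟨s, h1, h2⟩
    exact ⟨n, hn⟩

lemma IsContBrownian.measure_exceed_shift (hB : IsContBrownian B P) (u a : ℝ≥0) (r : ℝ) :
    P {ω | (fun t => B (u + t) ω - B u ω) ∈ exceed a r} = P {ω | (B · ω) ∈ exceed a r} :=
  (hB.shift u).measure_eq hB (measurableSet_exceed a r)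

lemma IsContBrownian.measure_exceed_scale (hB : IsContBrownian B P) {a b : ℝ≥0} {r s : ℝ≥0}
    (hr : 0 < r) (h : a = b * r ^ 2) :
    P {ω | (B · ω) ∈ exceed a (r * s)} = P {ω | (B · ω) ∈ exceed b s} := by
  rw [← (hB.smul (pow_ne_zero 2 hr.ne')).measure_eq hB (measurableSet_exceed b s)]
  congr 1 with ω
  have hc := hB.cont ω
  have hr' : (0 : ℝ) < r := hr
  simp only [Set.mem_ofPred_eq]
  rw [mem_exceed hc, mem_exceed (by fun_prop)]
  have key (q : ℝ≥0) : (s : ℝ) < |(√((r ^ 2 : ℝ≥0) : ℝ))⁻¹ * B (r ^ 2 * q) ω| ↔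
      (r * s : ℝ) < |B (r ^ 2 * q) ω| := by
    rw [NNReal.coe_pow, Real.sqrt_sq hr'.le, abs_mul, abs_of_pos (inv_pos.2 hr'),
      inv_mul_eq_div, lt_div_iff₀' hr']
  simp only [key]
  constructor
  · rintro ⟨q, hq, hq'⟩
    refine ⟨q / r ^ 2, ?_, ?_⟩
    · rwa [div_lt_iff₀ (by positivity), ← h]
    · rwa [mul_div_cancel₀ _ (by positivity)]
  · rintro ⟨q, hq, hq'⟩
    refine ⟨r ^ 2 * q, ?_, hq'⟩
    rw [h, mul_comm]
    gcongr

lemma exceed_mono {a b : ℝ≥0} (h : a ≤ b) (r : ℝ) : exceed a r ⊆ exceed b r :=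
  fun _ ⟨n, h1, h2⟩ => ⟨n, h1.trans_le h, h2⟩

/-- Scaling reduces to `r = 1`; there the events decrease to the empty set as the time shrinks,
since paths are continuous and start at `0`. -/
lemma IsContBrownian.exists_measure_exceed_le (hB : IsContBrownian B P) {ε : ℝ≥0∞} (hε : ε ≠ 0) :
    ∃ θ : ℝ≥0, 0 < θ ∧ ∀ (a r : ℝ≥0), 0 < r → a ≤ θ * r ^ 2 →
      P {ω | (B · ω) ∈ exceed a r} ≤ ε := by
  have := hB.isProbabilityMeasure
  suffices h : ∃ θ : ℝ≥0, 0 < θ ∧ P {ω | (B · ω) ∈ exceed θ (1 : ℝ≥0)} ≤ ε by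
    obtain ⟨θ, hθ, h⟩ := h
    refine ⟨θ, hθ, fun a r hr ha => ?_⟩
    rw [← hB.measure_exceed_scale hr rfl] at h
    refine (measure_mono fun ω hω => ?_).trans h
    simpa using exceed_mono ha r hω
  have hm (a : ℝ≥0) : MeasurableSet {ω | (B · ω) ∈ exceed a (1 : ℝ≥0)} :=
    measurable_pi_lambda _ hB.meas (measurableSet_exceed a _)
  have hlim := tendsto_measure_iInter_atTop (μ := P)
    (s := fun n : ℕ => {ω | (B · ω) ∈ exceed (1 / (n + 1 : ℝ≥0)) (1 : ℝ≥0)})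
    (fun n => (hm _).nullMeasurableSet)
    (fun m n h => Set.preimage_mono (f := fun ω => (B · ω))
      (exceed_mono (a := 1 / (n + 1 : ℝ≥0)) (b := 1 / (m + 1 : ℝ≥0)) (by gcongr) _))
    ⟨0, measure_ne_top _ _⟩
  have hempty : ⋂ n : ℕ, {ω | (B · ω) ∈ exceed (1 / (n + 1 : ℝ≥0)) (1 : ℝ≥0)} = ∅ := by
    refine Set.eq_empty_of_forall_notMem fun ω hω => ?_
    simp only [Set.mem_iInter, Set.mem_ofPred_eq, mem_exceed (hB.cont ω)] at hω
    have h0 : ∀ᶠ s in 𝓝 (0 : ℝ≥0), |B s ω| < 1 :=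
      ((hB.cont ω).abs.tendsto 0).eventually_lt_const (by simp [hB.zero ω])
    obtain ⟨δ, hδ, h⟩ := Metric.eventually_nhds_iff.1 h0
    obtain ⟨n, hn⟩ := exists_nat_one_div_lt hδ
    obtain ⟨s, hs, hs'⟩ := hω n
    refine lt_asymm (h (y := s) ?_) (by simpa using hs')
    rw [NNReal.dist_eq, NNReal.coe_zero, sub_zero, NNReal.abs_eq]
    exact lt_trans (by exact_mod_cast hs) hn
  rw [hempty, measure_empty] at hlim
  obtain ⟨n, hn⟩ := (hlim.eventually_le_const (pos_iff_ne_zero.2 hε)).exists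
  exact ⟨_, by positivity, hn⟩

/-- On the compact interval `[0, u]` the distance to `z` attains its minimum, so a visit means that
it gets arbitrarily small on a dense set of times. -/
lemma measurableSet_exists_eq {m : MeasurableSpace Ω} {u : ℝ≥0} (hB : ∀ s ≤ u, Measurable[m] (B s))
    (hc : ∀ ω, Continuous (B · ω)) (z : ℝ) : MeasurableSet[m] {ω | ∃ s ≤ u, B s ω = z} := by
  have : {ω | ∃ s ≤ u, B s ω = z} =
      ⋂ n : ℕ, ⋃ k, {ω | |B (denseSeq (Set.Iic u) k) ω - z| < 1 / (n + 1 : ℝ)} := by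
    ext ω
    simp only [Set.mem_ofPred_eq, Set.mem_iInter, Set.mem_iUnion]
    have hc' : Continuous fun s : Set.Iic u => |B s ω - z| := by
      have := hc ω
      fun_prop
    constructor
    · rintro ⟨s, hs, rfl⟩ n
      obtain ⟨k, hk⟩ := (denseRange_denseSeq (Set.Iic u)).exists_mem_open
        (isOpen_lt hc' (continuous_const (y := 1 / (n + 1 : ℝ))))
        ⟨⟨s, hs⟩, by simp; positivity⟩
      exact ⟨k, hk⟩
    · intro h
      have : CompactSpace (Set.Iic u) := by
        rw [← isCompact_iff_compactSpace, ← Set.Icc_bot]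
        exact isCompact_Icc
      obtain ⟨s, -, hs⟩ := isCompact_univ.exists_isMinOn ⟨⟨0, Set.mem_Iic.2 bot_le⟩, trivial⟩
        hc'.continuousOn
      refine ⟨s, s.2, sub_eq_zero.1 (abs_eq_zero.1 ?_)⟩
      by_contra h0
      have hpos : 0 < |B s ω - z| := lt_of_le_of_ne (abs_nonneg _) (Ne.symm h0)
      obtain ⟨n, hn⟩ := exists_nat_one_div_lt hpos
      obtain ⟨k, hk⟩ := h n
      exact absurd (hs (Set.mem_univ (denseSeq (Set.Iic u) k))) (not_le.2 (hk.trans hn))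
  rw [this]
  refine .iInter fun n => .iUnion fun k => measurableSet_lt ?_ measurable_const
  exact ((hB _ (denseSeq (Set.Iic u) k).2).sub_const z).abs

end Brownian

/-! ### Slow crossing of flat intervals. -/

section Crossing

variable {Ω : Type*} {mΩ : MeasurableSpace Ω} {P : Measure Ω} {B : ℝ≥0 → Ω → ℝ}

/-- The event that the path visits `z` at the `k`-th point of the grid of mesh `δ` or before,
but not before the previous grid points. -/
def firstVisit (B : ℝ≥0 → Ω → ℝ) (z : ℝ) (δ : ℝ≥0) (k : ℕ) : Set Ω :=
  {ω | (∃ s ≤ k * δ, B s ω = z) ∧ ∀ j < k, ¬ ∃ s ≤ j * δ, B s ω = z}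

lemma IsContBrownian.measurableSet_firstVisit (hB : IsContBrownian B P) (z : ℝ) (δ : ℝ≥0) (k : ℕ) :
    MeasurableSet[past B (k * δ)] (firstVisit B z δ k) := by
  have h1 (j : ℕ) (hj : j ≤ k) : MeasurableSet[past B (k * δ)] {ω | ∃ s ≤ j * δ, B s ω = z} :=
    measurableSet_exists_eq (fun s hs => measurable_past (hs.trans (by gcongr))) hB.cont z
  have : firstVisit B z δ k =
      {ω | ∃ s ≤ k * δ, B s ω = z} ∩ ⋂ j, ⋂ _ : j < k, {ω | ∃ s ≤ j * δ, B s ω = z}ᶜ := by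
    ext; simp [firstVisit]
  rw [this]
  exact (h1 k le_rfl).inter (.iInter fun j => .iInter fun hj => (h1 j hj.le).compl)

lemma pairwise_disjoint_firstVisit (z : ℝ) (δ : ℝ≥0) :
    Pairwise (Function.onFun Disjoint (firstVisit B z δ)) := by
  rintro j k hjk
  refine Set.disjoint_left.2 fun ω hj hk => ?_
  rcases hjk.lt_or_gt with h | h
  · exact hk.2 j h hj.1
  · exact hj.2 k h hk.1

/-- Markov property on a grid: after the first grid point that follows a visit to `z`, the process
moves away no faster than from its starting point. -/
lemma IsContBrownian.measure_iUnion_firstVisit_le (hB : IsContBrownian B P) (z : ℝ) (δ a : ℝ≥0)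
    (r : ℝ) :
    P (⋃ k : ℕ, firstVisit B z δ k ∩
      {ω | (fun t => B (k * δ + t) ω - B (k * δ) ω) ∈ exceed a r}) ≤
      P {ω | (B · ω) ∈ exceed a r} := by
  have := hB.isProbabilityMeasure
  have hF (k : ℕ) : MeasurableSet (firstVisit B z δ k) :=
    past_le hB.meas _ _ (hB.measurableSet_firstVisit z δ k)
  calc _ ≤ ∑' k : ℕ, P (firstVisit B z δ k ∩
        {ω | (fun t => B (k * δ + t) ω - B (k * δ) ω) ∈ exceed a r}) := measure_iUnion_le _
    _ = ∑' k : ℕ, P (firstVisit B z δ k) * P {ω | (B · ω) ∈ exceed a r} := by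
        congr 1 with k
        rw [← hB.measure_exceed_shift (k * δ) a r]
        exact hB.measure_inter _ (hB.measurableSet_firstVisit z δ k)
          ⟨_, measurableSet_exceed a r, rfl⟩
    _ = P (⋃ k, firstVisit B z δ k) * P {ω | (B · ω) ∈ exceed a r} := by
        rw [ENNReal.tsum_mul_right, measure_iUnion (pairwise_disjoint_firstVisit z δ) hF]
    _ ≤ 1 * P {ω | (B · ω) ∈ exceed a r} := by gcongr; exact prob_le_one
    _ = _ := one_mul _

lemma exists_mem_firstVisit {z : ℝ} {δ σ : ℝ≥0} {ω : Ω} (hδ : 0 < δ) (hσ : B σ ω = z)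
    (hfirst : ∀ s < σ, B s ω ≠ z) :
    ∃ k : ℕ, ω ∈ firstVisit B z δ k ∧ σ ≤ k * δ ∧ k * δ ≤ σ + δ := by
  classical
  have hex : ∃ k : ℕ, ∃ s ≤ k * δ, B s ω = z := by
    obtain ⟨k, hk⟩ := exists_nat_ge (σ / δ)
    exact ⟨k, σ, by rwa [← div_le_iff₀ hδ], hσ⟩
  refine ⟨Nat.find hex, ⟨Nat.find_spec hex, fun j hj => Nat.find_min hex hj⟩, ?_, ?_⟩
  · obtain ⟨s, hs, hs'⟩ := Nat.find_spec hex
    by_contra! h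
    exact hfirst s (hs.trans_lt h) hs'
  · rcases h : Nat.find hex with _ | k
    · simp
    · have h1 := Nat.find_min hex (m := k) (by omega)
      have h2 : k * δ < σ := by
        by_contra! h2
        exact h1 ⟨σ, h2, hσ⟩
      push_cast
      rw [add_mul, one_mul]
      gcongr

/-- The event that, within a time less than `a` after its first visit to `z`, the path is at
distance at least `r` from `z`. -/
def leaveFast (B : ℝ≥0 → Ω → ℝ) (z r : ℝ) (a : ℝ≥0) : Set Ω :=
  {ω | ∃ σ v, B σ ω = z ∧ (∀ s < σ, B s ω ≠ z) ∧ σ ≤ v ∧ v < σ + a ∧ r ≤ |B v ω - z|}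

/-- A substitute for the strong Markov property at the first visit `σ`. For a fine mesh, the path at
the grid point following `σ` is still within `r / 2` of `z`, so it must move by at least `r / 2 > r
/ 3` from there. Each mesh obeys the same bound, which passes to the liminf of the events. -/
lemma IsContBrownian.measure_leaveFast_le (hB : IsContBrownian B P) (z : ℝ) {r : ℝ} (hr : 0 < r)
    (a : ℝ≥0) : P (leaveFast B z r a) ≤ P {ω | (B · ω) ∈ exceed a (r / 3)} := by
  let E (m : ℕ) : Set Ω := ⋃ k : ℕ, firstVisit B z (1 / (m + 1)) k ∩
    {ω | (fun t => B (k * (1 / (m + 1)) + t) ω - B (k * (1 / (m + 1))) ω) ∈ exceed a (r / 3)}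
  have hsub : leaveFast B z r a ⊆ ⋃ N, ⋂ m ≥ N, E m := by
    rintro ω ⟨σ, v, hσ, hfirst, hσv, hva, hrv⟩
    have hc := hB.cont ω
    have hσv' : σ < v := by
      refine lt_of_le_of_ne hσv fun h => ?_
      rw [← h, hσ, sub_self, abs_zero] at hrv
      exact absurd hrv (not_le.2 hr)
    have h0 : ∀ᶠ s in 𝓝 σ, |B s ω - z| < r / 2 ∧ s < v := by
      have h1 : ∀ᶠ s in 𝓝 σ, |B s ω - z| < r / 2 :=
        (((hc.sub continuous_const).abs).tendsto σ).eventually_lt_const (by simp [hσ, hr])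
      exact h1.and (gt_mem_nhds hσv')
    obtain ⟨δ, hδ, h⟩ := Metric.eventually_nhds_iff.1 h0
    obtain ⟨N, hN⟩ := exists_nat_one_div_lt hδ
    simp only [Set.mem_iUnion, Set.mem_iInter]
    refine ⟨N, fun m hm => ?_⟩
    obtain ⟨k, hk, hk1, hk2⟩ :=
      exists_mem_firstVisit (δ := 1 / (m + 1)) (by positivity) hσ hfirst
    refine Set.mem_iUnion.2 ⟨k, hk, ?_⟩
    obtain ⟨h1, h2⟩ := h (y := k * (1 / (m + 1))) (by
      rw [dist_comm, NNReal.dist_eq, abs_sub_comm,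
        abs_of_nonneg (sub_nonneg.2 (by exact_mod_cast hk1))]
      have h3 : ((k * (1 / (m + 1)) : ℝ≥0) : ℝ) ≤ σ + 1 / (m + 1) := by exact_mod_cast hk2
      have h4 : (1 : ℝ) / (m + 1) ≤ 1 / (N + 1) := by gcongr
      linarith)
    have hadd : k * (1 / (m + 1 : ℝ≥0)) + (v - k * (1 / (m + 1))) = v := add_tsub_cancel_of_le h2.le
    refine (mem_exceed ((hB.shift _).cont ω)).2 ⟨v - k * (1 / (m + 1)), ?_, ?_⟩
    · rw [tsub_lt_iff_left h2.le]
      exact hva.trans_le (by gcongr)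
    · rw [hadd]
      have h5 := abs_sub_abs_le_abs_sub (B v ω - z) (B (k * (1 / (m + 1))) ω - z)
      rw [sub_sub_sub_cancel_right] at h5
      linarith
  have hmono : Monotone fun N => ⋂ m ≥ N, E m := fun M N h =>
    Set.biInter_mono (fun m hm => h.trans hm) fun _ _ => le_rfl
  calc P (leaveFast B z r a) ≤ P (⋃ N, ⋂ m ≥ N, E m) := measure_mono hsub
    _ = ⨆ N, P (⋂ m ≥ N, E m) := hmono.measure_iUnion
    _ ≤ _ := iSup_le fun N => (measure_mono
        (Set.biInter_subset_of_mem (Set.mem_Ici.2 le_rfl))).trans (hB.measure_iUnion_firstVisit_le z _ a _)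

lemma IsContBrownian.exists_measure_leaveFast_le (hB : IsContBrownian B P) {ε : ℝ≥0∞}
    (hε : ε ≠ 0) : ∃ θ : ℝ, 0 < θ ∧ ∀ (z r : ℝ) (a : ℝ≥0), 0 < r → a ≤ θ * r ^ 2 →
      P (leaveFast B z r a) ≤ ε := by
  obtain ⟨θ, hθ, h⟩ := hB.exists_measure_exceed_le hε
  refine ⟨θ / 9, by positivity, fun z r a hr ha => (hB.measure_leaveFast_le z hr a).trans ?_⟩
  have := h a (r / 3).toNNReal (by simpa using hr) (by
    rw [← NNReal.coe_le_coe]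
    push_cast
    rw [Real.coe_toNNReal _ (by positivity)]
    linarith)
  rwa [Real.coe_toNNReal _ (by positivity)] at this

/-- The environment `w` oscillates by at most `c` on the interval of radius `ℓ` around `L`. -/
def FlatAt (w : C(ℝ, ℝ)) (c ℓ L : ℝ) : Prop := ∀ y, |y - L| ≤ ℓ → |w y - w L| ≤ c

lemma FlatAt.le_scale_sub {w : C(ℝ, ℝ)} {c ℓ L x y : ℝ} (h : FlatAt w c ℓ L) (hx : L - ℓ ≤ x)
    (hxy : x ≤ y) (hy : y ≤ L + ℓ) :
    Real.exp (w L - c) * (y - x) ≤ scale w y - scale w x := by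
  have hc : Continuous fun y => Real.exp (w y) := by fun_prop
  have : scale w y - scale w x = ∫ s in x..y, Real.exp (w s) :=
    intervalIntegral.integral_interval_sub_left (hc.intervalIntegrable _ _)
      (hc.intervalIntegrable _ _)
  rw [this]
  calc Real.exp (w L - c) * (y - x) = ∫ s in x..y, Real.exp (w L - c) := by simp [mul_comm]
    _ ≤ _ := intervalIntegral.integral_mono_on hxy (by simp) (hc.intervalIntegrable _ _) ?_
  intro s hs
  have := abs_le.1 (h s (abs_le.2 ⟨by linarith [hs.1], by linarith [hs.2]⟩))
  exact Real.exp_le_exp.2 (by linarith)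

lemma FlatAt.abs_lt_of_abs_scale_lt {w : Env} {c ℓ L : ℝ} (h : FlatAt w.1 c ℓ L) (hℓ : 0 ≤ ℓ)
    {y : ℝ} (hy : |y - scale w.1 L| < Real.exp (w.1 L - c) * ℓ) : |scaleInv w.1 y - L| < ℓ := by
  have h1 := h.le_scale_sub (x := L - ℓ) (y := L) le_rfl (by linarith) (by linarith)
  have h2 := h.le_scale_sub (x := L) (y := L + ℓ) (by linarith) (by linarith) le_rfl
  have h3 := abs_lt.1 hy
  rw [abs_lt]
  constructor
  · have := (lt_scaleInv_iff w.2 (x := L - ℓ) (y := y)).2 (by ring_nf at h1 h3 ⊢; linarith)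
    linarith
  · have := (scaleInv_lt_iff w.2 (x := L + ℓ) (y := y)).2 (by ring_nf at h2 h3 ⊢; linarith)
    linarith

/-- The driving path `y + B`. -/
def drive (hB : IsContBrownian B P) (y : ℝ) (ω : Ω) : C(ℝ≥0, ℝ) :=
  ⟨fun s => y + B s ω, continuous_const.add (hB.cont ω)⟩

/-- A diffusion needs a long time to leave a long interval on which the environment is flat,
from its first visit to the centre of the interval on. -/
lemma IsContBrownian.exists_measure_cross_le (hB : IsContBrownian B P) {ε : ℝ≥0∞} (hε : ε ≠ 0)
    (t : ℝ≥0) (c : ℝ) : ∃ ℓ₀ : ℝ, ∀ ℓ > 0, ℓ₀ ≤ ℓ → ∀ (w : Env) (L : ℝ), FlatAt w.1 c ℓ L → ∀ y : ℝ,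
      P {ω | ∃ u, (∃ s ≤ u, y + B s ω = scale w.1 L) ∧
        ℓ ≤ |scaleInv w.1 (y + B u ω) - L| ∧ clock w.1 (drive hB y ω) u ≤ t} ≤ ε := by
  obtain ⟨θ, hθ, h⟩ := hB.exists_measure_leaveFast_le hε
  -- This is what `2 * a ≤ θ * r ^ 2` requires after `w L` cancels; the summand `1` gives `ℓ ≤ ℓ ^
  -- 2`.
  refine ⟨2 * (t + 1) * Real.exp (4 * c) / θ + 1, fun ℓ hℓ hℓ₀ w L hflat y => ?_⟩
  set r : ℝ := Real.exp (w.1 L - c) * ℓ with hr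
  have hr0 : 0 < r := by positivity
  -- At the least rate `exp (-2 * (w L + c))` on the flat interval, the clock gains `t + 1` during
  -- time `a`. The window `2 * a` below leaves room for the endpoint `σ + a`.
  obtain ⟨a, ha⟩ : ∃ a : ℝ≥0, (a : ℝ) = (t + 1) * Real.exp (2 * (w.1 L + c)) :=
    ⟨⟨_, by positivity⟩, rfl⟩
  refine (measure_mono ?_).trans (h (scale w.1 L - y) r (2 * a) hr0 ?_)
  · rintro ω ⟨u, ⟨s, hsu, hs⟩, hℓu, hu⟩
    by_contra hω
    have hc := hB.cont ω
    obtain ⟨σ, hσs, hσ, hfirst⟩ : ∃ σ ≤ s, B σ ω = scale w.1 L - y ∧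
        ∀ q < σ, B q ω ≠ scale w.1 L - y := by
      have hcl : IsClosed {q | B q ω = scale w.1 L - y} := isClosed_eq hc continuous_const
      have hsm : s ∈ {q | B q ω = scale w.1 L - y} := by
        simp only [Set.mem_ofPred_eq]; linarith
      refine ⟨sInf {q | B q ω = scale w.1 L - y}, csInf_le (OrderBot.bddBelow _) hsm,
        hcl.csInf_mem ⟨s, hsm⟩ (OrderBot.bddBelow _), fun q hq hq' => ?_⟩
      exact absurd (csInf_le (s := {q | B q ω = scale w.1 L - y}) (OrderBot.bddBelow _) hq')
        (not_le.2 hq)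
    have hnear : ∀ v, σ ≤ v → v < σ + 2 * a → |y + B v ω - scale w.1 L| < r := by
      intro v h1 h2
      by_contra! h3
      exact hω ⟨σ, v, hσ, hfirst, h1, h2, by rwa [show B v ω - (scale w.1 L - y) =
        y + B v ω - scale w.1 L by ring]⟩
    have ha0 : 0 < a := by
      rw [← NNReal.coe_pos, ha]; positivity
    have hσu : σ + a ≤ u := by
      by_contra! h1
      have h2 := hflat.abs_lt_of_abs_scale_lt hℓ.le (hnear u (hσs.trans hsu)
        (h1.trans (by gcongr; exact lt_mul_of_one_lt_left ha0 one_lt_two)))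
      exact absurd hℓu (not_le.2 h2)
    have h1 := le_clock_sub w (drive hB y ω) (u := σ) (v := σ + a) (by simp)
      (m := Real.exp (-2 * (w.1 L + c))) fun v hv1 hv2 => by
        have h2 := hflat.abs_lt_of_abs_scale_lt hℓ.le (hnear v hv1
          (hv2.trans_lt (by gcongr; exact lt_mul_of_one_lt_left ha0 one_lt_two)))
        have h3 := (abs_le.1 (hflat _ h2.le)).2
        refine Real.exp_le_exp.2 ?_
        change _ ≤ -2 * w.1 (scaleInv w.1 (y + B v ω))
        linarith
    have h2 := (clock_strictMono w (drive hB y ω)).monotone hσu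
    have h3 : clock w.1 (drive hB y ω) 0 ≤ clock w.1 (drive hB y ω) σ :=
      (clock_strictMono w (drive hB y ω)).monotone bot_le
    rw [clock_zero] at h3
    have h4 : Real.exp (-2 * (w.1 L + c)) * (((σ + a : ℝ≥0) : ℝ) - σ) = t + 1 := by
      rw [NNReal.coe_add, add_sub_cancel_left, ha, mul_left_comm, ← Real.exp_add]
      simp
    linarith
  · have h1 : (1 : ℝ) ≤ ℓ := le_trans (by simp; positivity) hℓ₀
    have h2 : 2 * (t + 1) * Real.exp (4 * c) ≤ θ * ℓ ^ 2 := by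
      have : 2 * (t + 1) * Real.exp (4 * c) / θ ≤ ℓ := by linarith
      rw [div_le_iff₀ hθ] at this
      nlinarith [mul_nonneg (mul_nonneg hθ.le hℓ.le) (sub_nonneg.2 h1)]
    have h3 : r ^ 2 = Real.exp (2 * (w.1 L + c)) * Real.exp (-(4 * c)) * ℓ ^ 2 := by
      rw [hr, mul_pow, ← Real.exp_nat_mul, ← Real.exp_add]
      congr 2
      push_cast; ring
    rw [h3, NNReal.coe_mul, ha, NNReal.coe_ofNat]
    calc 2 * ((t + 1) * Real.exp (2 * (w.1 L + c)))
        = (2 * (t + 1) * Real.exp (4 * c)) *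
          (Real.exp (2 * (w.1 L + c)) * Real.exp (-(4 * c))) := by
          rw [Real.exp_neg]; field_simp
      _ ≤ (θ * ℓ ^ 2) * (Real.exp (2 * (w.1 L + c)) * Real.exp (-(4 * c))) := by gcongr
      _ = _ := by ring

end Crossing

/-! ### Small-ball positivity, zero-one law, flat blocks infinitely often. -/

section SmallBall

open TopologicalSpace (denseSeq denseRange_denseSeq)

variable {Ω : Type*} {mΩ : MeasurableSpace Ω} {P : Measure Ω} {B : ℝ≥0 → Ω → ℝ}

/-- The paths that stay in `[-r, r]` up to time `a`. -/
def stay (a : ℝ≥0) (r : ℝ) : Set (ℝ≥0 → ℝ) :=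
  {x | ∀ k, |x (denseSeq (Set.Iic a) k)| ≤ r}

lemma mem_stay {a : ℝ≥0} {r : ℝ} {x : ℝ≥0 → ℝ} (hx : Continuous x) :
    x ∈ stay a r ↔ ∀ s ≤ a, |x s| ≤ r := by
  refine ⟨fun h s hs => ?_, fun h k => h _ (denseSeq (Set.Iic a) k).2⟩
  exact (denseRange_denseSeq (Set.Iic a)).induction_on (p := fun s : Set.Iic a => |x s| ≤ r)
    ⟨s, hs⟩ (isClosed_le (by fun_prop) continuous_const) h

lemma measurableSet_mem_stay {m : MeasurableSpace Ω} {a : ℝ≥0} (r : ℝ)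
    (hB : ∀ s ≤ a, Measurable[m] (B s)) : MeasurableSet[m] {ω | (B · ω) ∈ stay a r} := by
  have : {ω | (B · ω) ∈ stay a r} = ⋂ k, {ω | |B (denseSeq (Set.Iic a) k) ω| ≤ r} := by
    ext; simp [stay]
  rw [this]
  exact .iInter fun k => measurableSet_le (hB _ (denseSeq (Set.Iic a) k).2).abs measurable_const

lemma measurableSet_stay (a : ℝ≥0) (r : ℝ) : MeasurableSet (stay a r) :=
  measurableSet_mem_stay (B := fun s (x : ℝ≥0 → ℝ) => x s) r fun s _ => measurable_pi_apply s

lemma compl_exceed_subset_stay {a : ℝ≥0} (ha : 0 < a) {r : ℝ} {x : ℝ≥0 → ℝ} (hx : Continuous x)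
    (h : x ∉ exceed a r) : x ∈ stay a r := by
  rw [mem_exceed hx] at h
  push Not at h
  rw [mem_stay hx]
  intro s hs
  have hcl : closure (Set.Iio a) ⊆ {s | |x s| ≤ r} :=
    closure_minimal (fun s hs => h s hs) (isClosed_le hx.abs continuous_const)
  rw [closure_Iio' (a := a) ⟨0, ha⟩] at hcl
  exact hcl hs

/-- The paths that stay in `[-r, r]` up to time `a` and are nonnegative at time `a`. -/
def stayUp (a : ℝ≥0) (r : ℝ) : Set (ℝ≥0 → ℝ) := stay a r ∩ {x | 0 ≤ x a}

/-- The paths that stay in `[-r, r]` up to time `a` and are nonpositive at time `a`. -/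
def stayDown (a : ℝ≥0) (r : ℝ) : Set (ℝ≥0 → ℝ) := stay a r ∩ {x | x a ≤ 0}

lemma measurableSet_stayUp (a : ℝ≥0) (r : ℝ) : MeasurableSet (stayUp a r) :=
  (measurableSet_stay a r).inter (measurableSet_le measurable_const (measurable_pi_apply a))

lemma measurableSet_stayDown (a : ℝ≥0) (r : ℝ) : MeasurableSet (stayDown a r) :=
  (measurableSet_stay a r).inter (measurableSet_le (measurable_pi_apply a) measurable_const)

lemma IsContBrownian.measure_stayDown (hB : IsContBrownian B P) (a : ℝ≥0) (r : ℝ) :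
    P {ω | (B · ω) ∈ stayDown a r} = P {ω | (B · ω) ∈ stayUp a r} := by
  rw [← hB.neg.measure_eq hB (measurableSet_stayUp a r)]
  congr 1 with ω
  simp [stayUp, stayDown, stay]

/-- By symmetry both signs at the end are equally likely; were they null, the path would leave `[-r,
r]` almost surely, against a bound of `1 / 2`. -/
lemma IsContBrownian.exists_measure_stayUp_pos (hB : IsContBrownian B P) {r : ℝ} (hr : 0 < r) :
    ∃ θ : ℝ≥0, 0 < θ ∧ P {ω | (B · ω) ∈ stayUp θ r} ≠ 0 := by
  have := hB.isProbabilityMeasure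
  obtain ⟨θ, hθ, h⟩ := hB.exists_measure_exceed_le (ε := 1 / 2) (by simp)
  lift r to ℝ≥0 using hr.le
  have hr' : 0 < r := hr
  have hpos : 0 < θ * r ^ 2 := by positivity
  refine ⟨θ * r ^ 2, hpos, fun h0 => ?_⟩
  have h1 : (Set.univ : Set Ω) ⊆ {ω | (B · ω) ∈ exceed (θ * r ^ 2) r} ∪
      ({ω | (B · ω) ∈ stayUp (θ * r ^ 2) r} ∪ {ω | (B · ω) ∈ stayDown (θ * r ^ 2) r}) := by
    intro ω _
    by_cases hω : (B · ω) ∈ exceed (θ * r ^ 2) r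
    · exact Or.inl hω
    · have h2 := compl_exceed_subset_stay hpos (hB.cont ω) hω
      exact Or.inr ((le_total 0 (B (θ * r ^ 2) ω)).imp (fun h => ⟨h2, h⟩) fun h => ⟨h2, h⟩)
  have h2 := (measure_mono (μ := P) h1).trans (measure_union_le _ _)
  rw [measure_union_null h0 (by rwa [hB.measure_stayDown]), measure_univ, add_zero] at h2
  have h3 := h2.trans (h _ r hr' le_rfl)
  exact absurd h3 (by simp)

lemma measurable_sub_future {u a b : ℝ≥0} (ha : u ≤ a) (hb : u ≤ b) :
    Measurable[future B u] fun ω => B a ω - B b ω := by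
  have h1 := measurable_future (B := B) u (a - u)
  have h2 := measurable_future (B := B) u (b - u)
  rw [add_tsub_cancel_of_le ha] at h1
  rw [add_tsub_cancel_of_le hb] at h2
  convert h1.sub h2 using 1
  ext ω
  simp

/-- The event that the path stays in `[-2 r, 2 r]` up to time `u` and is in `[-r, r]` then. -/
def tube (B : ℝ≥0 → Ω → ℝ) (u : ℝ≥0) (r : ℝ) : Set Ω :=
  {ω | (B · ω) ∈ stay u (2 * r)} ∩ {ω | |B u ω| ≤ r}

lemma measurableSet_tube (u : ℝ≥0) (r : ℝ) :
    MeasurableSet[past B u] (tube B u r) :=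
  (measurableSet_mem_stay _ fun _ hs => measurable_past hs).inter
    (measurableSet_le (continuous_abs.measurable.comp (measurable_past le_rfl)) measurable_const)

/-- An increment that points back towards the origin keeps the endpoint in `[-r, r]`, and the
excursion on the way stays within `2 * r`. -/
lemma IsContBrownian.mem_tube_add (hB : IsContBrownian B P) {u θ : ℝ≥0} {r : ℝ} {ω : Ω}
    (h : ω ∈ tube B u r) (hs : (fun t => B (u + t) ω - B u ω) ∈ stay θ r)
    (hsign : (B u ω ≤ 0 ∧ 0 ≤ B (u + θ) ω - B u ω) ∨ (0 ≤ B u ω ∧ B (u + θ) ω - B u ω ≤ 0)) :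
    ω ∈ tube B (u + θ) r := by
  have h1 := (mem_stay (hB.cont ω)).1 h.1
  have h2 := (mem_stay ((hB.shift u).cont ω)).1 hs
  have h3 := abs_le.1 (show |B u ω| ≤ r from h.2)
  refine ⟨(mem_stay (hB.cont ω)).2 fun s hs => ?_, ?_⟩
  · rcases le_total s u with hsu | hsu
    · exact h1 s hsu
    · have h4 := abs_le.1 (h2 (s - u) (tsub_le_iff_left.2 hs))
      rw [add_tsub_cancel_of_le hsu] at h4
      exact abs_le.2 ⟨by linarith, by linarith⟩
  · have h4 := abs_le.1 (h2 θ le_rfl)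
    change |B (u + θ) ω| ≤ r
    rw [abs_le]
    rcases hsign with h5 | h5 <;> constructor <;> linarith

lemma IsContBrownian.measure_tube_add (hB : IsContBrownian B P) (u θ : ℝ≥0) (r : ℝ) :
    P (tube B u r) * P {ω | (B · ω) ∈ stayUp θ r} ≤ P (tube B (u + θ) r) := by
  set q := P {ω | (B · ω) ∈ stayUp θ r} with hq
  set N : Set Ω := {ω | B u ω ≤ 0} with hN
  set U : Set Ω := {ω | (fun t => B (u + t) ω - B u ω) ∈ stayUp θ r}
  set D : Set Ω := {ω | (fun t => B (u + t) ω - B u ω) ∈ stayDown θ r}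
  have hNm : MeasurableSet[past B u] N := measurableSet_le (measurable_past le_rfl) measurable_const
  have hT := measurableSet_tube (B := B) u r
  have hU : MeasurableSet[future B u] U := ⟨_, measurableSet_stayUp θ r, rfl⟩
  have hD : MeasurableSet[future B u] D := ⟨_, measurableSet_stayDown θ r, rfl⟩
  have hPU : P U = q := (hB.shift u).measure_eq hB (measurableSet_stayUp θ r)
  have hPD : P D = q := by
    rw [hq, ← hB.measure_stayDown]
    exact (hB.shift u).measure_eq hB (measurableSet_stayDown θ r)
  have h1 : P (tube B u r ∩ N ∩ U) = P (tube B u r ∩ N) * q := by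
    rw [← hPU]
    exact hB.measure_inter u (hT.inter hNm) hU
  have h2 : P ((tube B u r \ N) ∩ D) = P (tube B u r \ N) * q := by
    rw [← hPD]
    exact hB.measure_inter u (hT.diff hNm) hD
  rw [← measure_inter_add_sdiff _ (past_le hB.meas u _ hNm), add_mul, ← h1, ← h2,
    ← measure_union ?_ ((past_le hB.meas u _ (hT.diff hNm)).inter (future_le hB.meas u _ hD))]
  · refine measure_mono ?_
    rintro ω (⟨⟨h3, h4⟩, h5⟩ | ⟨⟨h3, h4⟩, h5⟩)
    · exact hB.mem_tube_add h3 h5.1 (Or.inl ⟨h4, h5.2⟩)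
    · exact hB.mem_tube_add h3 h5.1 (Or.inr ⟨(not_le.1 h4).le, h5.2⟩)
  · exact Set.disjoint_left.2 fun ω h3 h4 => h4.1.2 h3.1.2

/-- Brownian motion stays close to `0` for a long time with positive probability. -/
lemma IsContBrownian.measure_stay_pos (hB : IsContBrownian B P) (a : ℝ≥0) {r : ℝ} (hr : 0 < r) :
    P {ω | (B · ω) ∈ stay a r} ≠ 0 := by
  have := hB.isProbabilityMeasure
  obtain ⟨θ, hθ, hq⟩ := hB.exists_measure_stayUp_pos (half_pos hr)
  have h (n : ℕ) : P (tube B (n * θ) (r / 2)) ≠ 0 := by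
    induction n with
    | zero =>
      have : tube B ((0 : ℕ) * θ) (r / 2) = Set.univ := by
        refine Set.eq_univ_of_forall fun ω => ⟨(mem_stay (hB.cont ω)).2 fun s hs => ?_, ?_⟩
        · have : s = 0 := by simpa using hs
          simp [this, hB.zero ω, (half_pos hr).le]
        · simp [hB.zero ω, (half_pos hr).le]
      rw [this]
      simp
    | succ n ih =>
      rw [Nat.cast_succ, add_mul, one_mul]
      exact fun h0 => mul_ne_zero ih hq (nonpos_iff_eq_zero.1
        ((hB.measure_tube_add _ _ _).trans_eq h0))
  obtain ⟨n, hn⟩ := exists_nat_ge (a / θ)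
  rw [div_le_iff₀ hθ] at hn
  refine fun h0 => h n (measure_mono_null (fun ω hω => ?_) h0)
  have h1 := (mem_stay (hB.cont ω)).1 hω.1
  exact (mem_stay (hB.cont ω)).2 fun s hs => (h1 s (hs.trans hn)).trans (by linarith)

/-- Zero-one law for events that only depend on the increments in the far future. -/
lemma IsContBrownian.measure_eq_zero_or_one (hB : IsContBrownian B P) {E : Set Ω}
    (hE : ∀ n : ℕ, MeasurableSet[future B n] E) : P E = 0 ∨ P E = 1 := by
  have := hB.isProbabilityMeasure
  -- `E` is independent of each past, hence of the `σ`-algebra they generate. That contains `E`, so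
  -- `E` is independent of itself.
  have h1 : Indep (⨆ n : ℕ, past B n) (MeasurableSpace.generateFrom {E}) P := by
    refine indep_iSup_of_monotone (fun n => ?_) (fun n => past_le hB.meas n) ?_
      fun m n h => past_mono (by exact_mod_cast h)
    · exact indep_of_indep_of_le_right (hB.indep_future_past n).symm
        (MeasurableSpace.generateFrom_singleton_le (hE n))
    · exact (MeasurableSpace.generateFrom_singleton_le (hE 0)).trans (future_le hB.meas _)
  have h2 : MeasurableSet[⨆ n : ℕ, past B n] E := by
    have h3 : future B ((0 : ℕ) : ℝ≥0) ≤ ⨆ n : ℕ, past B n := by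
      refine Measurable.comap_le (m₂ := inferInstance) ?_
      refine @measurable_pi_lambda _ _ _ (⨆ n : ℕ, past B n) _ _ fun t => ?_
      have h4 (s : ℝ≥0) : Measurable[⨆ n : ℕ, past B n] (B s) := by
        obtain ⟨n, hn⟩ := exists_nat_ge s
        exact (measurable_past hn).mono (le_iSup (fun n : ℕ => past B n) n) le_rfl
      exact (h4 _).sub (h4 _)
    exact h3 _ (hE 0)
  refine measure_eq_zero_or_one_of_indepSet_self ?_
  exact h1.indepSet_of_measurableSet h2 (MeasurableSpace.measurableSet_generateFrom rfl)

lemma IsContBrownian.half_le_measure_nonneg (hB : IsContBrownian B P) (u : ℝ≥0) :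
    1 / 2 ≤ P {ω | 0 ≤ B u ω} := by
  have := hB.isProbabilityMeasure
  have hS : MeasurableSet {x : ℝ≥0 → ℝ | 0 ≤ x u} :=
    measurableSet_le measurable_const (measurable_pi_apply u)
  have h1 : P {ω | B u ω ≤ 0} = P {ω | 0 ≤ B u ω} := by
    rw [← show P {ω | ((-B) · ω) ∈ {x : ℝ≥0 → ℝ | 0 ≤ x u}} = P {ω | 0 ≤ B u ω} from
      hB.neg.measure_eq hB hS]
    simp
  have h2 : (1 : ℝ≥0∞) ≤ P {ω | B u ω ≤ 0} + P {ω | 0 ≤ B u ω} := by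
    rw [← measure_univ (μ := P)]
    exact (measure_mono fun ω _ => le_total (B u ω) 0).trans (measure_union_le _ _)
  rw [h1, ← two_mul] at h2
  rw [ENNReal.div_le_iff_le_mul (by simp) (by simp)]
  rwa [mul_comm]

/-- The event that the path oscillates by at most `1/2` on `[u, u + c]`, around its value at `u`. -/
def flatBlock (B : ℝ≥0 → Ω → ℝ) (c u : ℝ≥0) : Set Ω :=
  {ω | (fun t => B (u + t) ω - B u ω) ∈ stay c (1 / 2)}

lemma measurableSet_flatBlock {c u v : ℝ≥0} (h : v ≤ u) :
    MeasurableSet[future B v] (flatBlock B c u) :=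
  measurableSet_mem_stay (B := fun t ω => B (u + t) ω - B u ω) _ fun _ _ =>
    measurable_sub_future (h.trans le_self_add) h

/-- The event that, on arbitrarily far blocks of length `c`, the path is flat and starts from
values that are bounded from below. -/
def flatOften (B : ℝ≥0 → Ω → ℝ) (c : ℕ) : Set Ω :=
  {ω | ∃ a : ℕ, ∀ N : ℕ, ∃ k ≥ N, ω ∈ flatBlock B c (k * c) ∧ -(a : ℝ) ≤ B (k * c) ω}

/-- Replacing `B (k * c)` by its increment from time `n` only changes the bound `a`, and blocks
before `n` can be dropped; so the event lies in every future. -/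
lemma measurableSet_flatOften {c : ℕ} (hc : 0 < c) (n : ℕ) :
    MeasurableSet[future B n] (flatOften B c) := by
  have : flatOften B c = ⋃ a : ℕ, ⋂ N : ℕ, ⋃ k : ℕ, ⋃ _ : N ≤ k ∧ n ≤ k,
      (flatBlock B c (k * c) ∩ {ω | -(a : ℝ) ≤ B (k * c) ω - B n ω}) := by
    ext ω
    simp only [flatOften, Set.mem_ofPred_eq, Set.mem_iUnion, Set.mem_iInter, Set.mem_inter_iff]
    constructor
    · rintro ⟨a, ha⟩
      obtain ⟨a', ha'⟩ := exists_nat_ge (a + B n ω)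
      refine ⟨a', fun N => ?_⟩
      obtain ⟨k, hk, h1, h2⟩ := ha (max N n)
      exact ⟨k, ⟨(le_max_left _ _).trans hk, (le_max_right _ _).trans hk⟩, h1, by linarith⟩
    · rintro ⟨a, ha⟩
      obtain ⟨a', ha'⟩ := exists_nat_ge (a - B n ω)
      refine ⟨a', fun N => ?_⟩
      obtain ⟨k, ⟨hk, -⟩, h1, h2⟩ := ha N
      exact ⟨k, hk, h1, by linarith⟩
  rw [this]
  refine .iUnion fun a => .iInter fun N => .iUnion fun k => .iUnion fun hk => ?_
  have h : (n : ℝ≥0) ≤ k * c := by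
    exact_mod_cast hk.2.trans (Nat.le_mul_of_pos_right k hc)
  exact (measurableSet_flatBlock h).inter
    (measurableSet_le measurable_const (measurable_sub_future h le_rfl))

/-- The events `E k` have probability at least `p / 2 > 0` for all `k`, hence so does their limsup;
the zero-one law lifts this to `1`. -/
lemma IsContBrownian.ae_flatOften (hB : IsContBrownian B P) {c : ℕ} (hc : 0 < c) :
    ∀ᵐ ω ∂P, ω ∈ flatOften B c := by
  have := hB.isProbabilityMeasure
  let E (k : ℕ) : Set Ω := {ω | 0 ≤ B (k * c) ω} ∩ flatBlock B c (k * c)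
  set p := P {ω | (B · ω) ∈ stay c (1 / 2)} with hp
  have hp0 : p ≠ 0 := hB.measure_stay_pos _ (by norm_num)
  have hfl (k : ℕ) : P (flatBlock B c (k * c)) = p :=
    (hB.shift _).measure_eq hB (measurableSet_stay _ _)
  have hpos (k : ℕ) : MeasurableSet[past B (k * c)] {ω | 0 ≤ B (k * c) ω} :=
    measurableSet_le measurable_const (measurable_past le_rfl)
  have hE (k : ℕ) : 1 / 2 * p ≤ P (E k) := by
    rw [← hfl k, hB.measure_inter (k * c) (hpos k) (measurableSet_flatBlock le_rfl)]
    gcongr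
    exact hB.half_le_measure_nonneg _
  have hEm (k : ℕ) : MeasurableSet (E k) := (past_le hB.meas _ _ (hpos k)).inter
    (future_le hB.meas _ _ (measurableSet_flatBlock le_rfl))
  have hlim := tendsto_measure_iInter_atTop (μ := P) (s := fun N : ℕ => ⋃ k ≥ N, E k)
    (fun N => (MeasurableSet.iUnion fun k => .iUnion fun _ => hEm k).nullMeasurableSet)
    (fun M N h => Set.biUnion_subset_biUnion_left fun k hk => h.trans hk) ⟨0, measure_ne_top _ _⟩
  have h1 : 1 / 2 * p ≤ P (⋂ N : ℕ, ⋃ k ≥ N, E k) :=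
    ge_of_tendsto' hlim fun N => (hE N).trans
      (measure_mono (Set.subset_biUnion_of_mem (u := E) (Set.mem_Ici.2 le_rfl)))
  have h2 : ⋂ N : ℕ, ⋃ k ≥ N, E k ⊆ flatOften B c := by
    intro ω hω
    refine ⟨0, fun N => ?_⟩
    obtain ⟨k, hk, h3, h4⟩ := by simpa using Set.mem_iInter.1 hω N
    exact ⟨k, hk, h4, by simpa using h3⟩
  have h3 : P (flatOften B c) ≠ 0 := fun h0 => by
    rw [measure_mono_null h2 h0] at h1
    simp [hp0] at h1
  have h4 := (hB.measure_eq_zero_or_one (measurableSet_flatOften hc)).resolve_left h3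
  rwa [← prob_compl_eq_zero_iff₀ ] at h4
  exact (future_le hB.meas _ _ (measurableSet_flatOften hc 0)).nullMeasurableSet

end SmallBall

/-! ### Almost every Brownian environment is good. -/

section Environment

/-- On the right half-line, the scale function is unbounded and there are arbitrarily long flat
intervals arbitrarily far away. -/
def GoodRight (w : C(ℝ, ℝ)) : Prop :=
  (∀ C, ∃ x, C ≤ scale w x) ∧ ∀ ℓ K : ℝ, ∃ L > K, FlatAt w 1 ℓ L

/-- The environment `x ↦ w(-x)`. -/
def reflect (w : C(ℝ, ℝ)) : C(ℝ, ℝ) := ⟨fun x => w (-x), by fun_prop⟩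

lemma scale_reflect (w : C(ℝ, ℝ)) (x : ℝ) : scale (reflect w) x = -scale w (-x) := by
  change ∫ y in (0 : ℝ)..x, Real.exp (w (-y)) = -∫ y in (0 : ℝ)..(-x), Real.exp (w y)
  rw [intervalIntegral.integral_comp_neg (fun y => Real.exp (w y)), neg_zero,
    intervalIntegral.integral_symm]

lemma surjective_scale {w : C(ℝ, ℝ)} (h : GoodRight w) (h' : GoodRight (reflect w)) :
    Function.Surjective (scale w) := by
  intro y
  obtain ⟨x, hx⟩ := h.1 y
  obtain ⟨x', hx'⟩ := h'.1 (-y)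
  rw [scale_reflect] at hx'
  exact mem_range_of_exists_le_of_exists_ge (continuous_scale w) ⟨-x', by linarith⟩ ⟨x, hx⟩

lemma FlatAt.of_reflect {w : C(ℝ, ℝ)} {c ℓ L : ℝ} (h : FlatAt (reflect w) c ℓ L) :
    FlatAt w c ℓ (-L) := by
  intro y hy
  have := h (-y) (by rw [← abs_neg]; convert hy using 2; ring)
  simpa [reflect] using this

lemma FlatAt.of_flatBlock {Ω : Type*} {B : ℝ≥0 → Ω → ℝ} {ω : Ω} (hc : Continuous (B · ω))
    {w : C(ℝ, ℝ)} (hw : ∀ x : ℝ≥0, B x ω = w x) {ℓ u : ℝ≥0} (h : ω ∈ flatBlock B (2 * ℓ) u) :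
    FlatAt w 1 ℓ (u + ℓ) := by
  have hc' : Continuous fun t => B (u + t) ω - B u ω := by fun_prop
  have h1 := (mem_stay hc').1 h
  have h2 : ∀ s : ℝ≥0, s ≤ 2 * ℓ → |w (u + s) - w u| ≤ 1 / 2 := fun s hs => by
    have := h1 s hs
    rwa [hw, hw, NNReal.coe_add] at this
  intro y hy
  obtain ⟨hy1, hy2⟩ := abs_le.1 hy
  have h3 := abs_le.1 (h2 (y - u).toNNReal (by
    rw [Real.toNNReal_le_iff_le_coe]; push_cast; linarith))
  have h4 := abs_le.1 (h2 ℓ (by rw [two_mul]; exact le_self_add))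
  rw [Real.coe_toNNReal _ (by linarith), add_sub_cancel] at h3
  exact abs_le.2 ⟨by linarith, by linarith⟩

/-- Blocks of length `2` starting at height at least `-a` each add at least `2 * exp (-a - 2)` to
the scale, so it cannot stay bounded. Blocks of length `2 * m` are flat intervals of radius `m`. -/
lemma goodRight_of_flatOften {Ω : Type*} {B : ℝ≥0 → Ω → ℝ} {ω : Ω} (hc : Continuous (B · ω))
    {w : C(ℝ, ℝ)} (hw : ∀ x : ℝ≥0, B x ω = w x)
    (h : ∀ c : ℕ, 0 < c → ω ∈ flatOften B c) : GoodRight w := by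
  have hmono := (scale_strictMono w).monotone
  constructor
  · by_contra! hC
    obtain ⟨C, hC⟩ := hC
    have hlim : Tendsto (scale w) atTop (𝓝 (⨆ x, scale w x)) :=
      tendsto_atTop_ciSup hmono ⟨C, by rintro _ ⟨x, rfl⟩; exact (hC x).le⟩
    have h0 : Tendsto (fun k : ℕ => scale w (k * 2 + 2) - scale w (k * 2)) atTop (𝓝 0) := by
      have hk : Tendsto (fun k : ℕ => (k : ℝ) * 2) atTop atTop :=
        tendsto_natCast_atTop_atTop.atTop_mul_const two_pos
      rw [← sub_self (⨆ x, scale w x)]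
      exact (hlim.comp (tendsto_atTop_add_const_right _ _ hk)).sub (hlim.comp hk)
    obtain ⟨a, ha⟩ := h 2 two_pos
    obtain ⟨N, hN⟩ := eventually_atTop.1
      (h0.eventually_lt_const (Real.exp_pos (-(a : ℝ) - 2)))
    obtain ⟨k, hk, h1, h2⟩ := ha N
    have h3 := FlatAt.of_flatBlock hc hw (ℓ := 1) (u := k * 2) (by simpa using h1)
    have h4 := h3.le_scale_sub (x := k * 2) (y := k * 2 + 2) (by simp) (by linarith)
      (by push_cast; linarith)
    have h5 := (abs_le.1 (h3 (k * 2) (by simp))).2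
    push_cast at h2 h4 h5
    rw [hw] at h2
    push_cast at h2
    have h6 : Real.exp (-(a : ℝ) - 2) ≤ Real.exp (w (k * 2 + 1) - 1) :=
      Real.exp_le_exp.2 (by linarith)
    have h7 := hN k hk
    have h8 := Real.exp_pos (w (k * 2 + 1) - 1)
    linarith
  · intro ℓ K
    obtain ⟨m, hm⟩ := exists_nat_ge (max ℓ 1)
    have hm1 : 1 ≤ m := by exact_mod_cast (le_max_right ℓ 1).trans hm
    obtain ⟨a, ha⟩ := h (2 * m) (by omega)
    obtain ⟨N, hN⟩ := exists_nat_ge K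
    obtain ⟨k, hk, h1, -⟩ := ha N
    have h3 := FlatAt.of_flatBlock hc hw (ℓ := m) (u := k * (2 * m)) (by simpa using h1)
    refine ⟨_, ?_, fun y hy => h3 y (hy.trans ((le_max_left ℓ 1).trans hm))⟩
    have h4 : (k : ℝ) ≤ k * (2 * m) := by
      exact_mod_cast Nat.le_mul_of_pos_right k (by omega)
    have h5 : (N : ℝ) ≤ k := by exact_mod_cast hk
    have h6 : (1 : ℝ) ≤ m := by exact_mod_cast hm1
    push_cast
    linarith

lemma ae_goodRight {Ω : Type*} {mΩ : MeasurableSpace Ω} {μ : Measure Ω} {W : Ω → C(ℝ, ℝ)}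
    (hW : IsBrownianReal (fun (x : ℝ≥0) ω => W ω (x : ℝ)) μ) : ∀ᵐ ω ∂μ, GoodRight (W ω) := by
  obtain ⟨V, hV, hVW⟩ := exists_isContBrownian hW
  have h : ∀ᵐ ω ∂μ, ∀ c : ℕ, 0 < c → ω ∈ flatOften V c :=
    ae_all_iff.2 fun _ => ae_all_iff.2 fun hc => hV.ae_flatOften hc
  filter_upwards [hVW, h] with ω h1 h2 using goodRight_of_flatOften (hV.cont ω) h1 h2

lemma ae_good {Ω : Type*} {mΩ : MeasurableSpace Ω} {μ : Measure Ω} {W : Ω → C(ℝ, ℝ)}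
    (hW : IsTwoSidedBrownian W μ) : ∀ᵐ ω ∂μ, GoodRight (W ω) ∧ GoodRight (reflect (W ω)) := by
  filter_upwards [ae_goodRight hW.right, ae_goodRight (W := fun ω => reflect (W ω)) hW.left]
    with ω h1 h2 using ⟨h1, h2⟩

end Environment

/-! ### Non-explosion, decay far from the origin, convergence of the semigroups. -/

section Semigroup

variable {Ω : Type*} {mΩ : MeasurableSpace Ω} {P : Measure Ω} {B : ℝ≥0 → Ω → ℝ}

lemma measurable_clock (hB : IsContBrownian B P) (w : Env) (y : ℝ) (u : ℝ≥0) :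
    Measurable fun ω => clock w.1 (drive hB y ω) u := by
  have h1 : Measurable (Function.uncurry fun (s : ℝ) ω => rate w.1 (y + B s.toNNReal ω)) := by
    refine measurable_uncurry_of_continuous_of_measurable (fun ω => ?_) fun s => ?_
    · have := hB.cont ω
      exact (continuous_rate w).comp (by fun_prop)
    · exact (continuous_rate w).measurable.comp ((hB.meas _).const_add y)
  have h2 : (fun ω => clock w.1 (drive hB y ω) u) = fun ω =>
      ∫ s in Set.Ioc (0 : ℝ) u, rate w.1 (y + B s.toNNReal ω) := by
    ext ω
    rw [clock_eq, intervalIntegral.integral_of_le (NNReal.coe_nonneg u)]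
    rfl
  rw [h2]
  exact (h1.stronglyMeasurable.integral_prod_left).measurable

lemma measurable_path (hB : IsContBrownian B P) (w : Env) (y : ℝ) (t : ℝ≥0) :
    Measurable fun ω => path w.1 (drive hB y ω) t := by
  have h1 : Measurable fun ω => clockInv w.1 (drive hB y ω) t := by
    refine measurable_of_Iic fun u => ?_
    have : (fun ω => clockInv w.1 (drive hB y ω) t) ⁻¹' Set.Iic u =
        {ω | (t : ℝ) ≤ clock w.1 (drive hB y ω) u} ∪
          ⋂ n : ℕ, {ω | clock w.1 (drive hB y ω) n < t} := by
      ext ω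
      simp [clockInv_le_iff]
    rw [this]
    exact (measurableSet_le measurable_const (measurable_clock hB w y u)).union
      (.iInter fun n => measurableSet_lt (measurable_clock hB w y n) measurable_const)
  have h2 : Measurable (Function.uncurry B) :=
    measurable_uncurry_of_continuous_of_measurable hB.cont hB.meas
  have h3 : Measurable fun ω => y + Function.uncurry B (clockInv w.1 (drive hB y ω) t, ω) :=
    (h2.comp (h1.prodMk measurable_id)).const_add y
  have h4 : Continuous (scaleInv w.1) :=
    continuous_scaleInv_uncurry.comp (Continuous.prodMk_right w)
  exact h4.measurable.comp h3

/-- A diffusion is unlikely to pass quickly through a long flat interval. -/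
lemma IsContBrownian.exists_measure_pass_le (hB : IsContBrownian B P) {ε : ℝ≥0∞} (hε : ε ≠ 0)
    (t : ℝ≥0) (c : ℝ) : ∃ ℓ : ℝ, 0 < ℓ ∧ ∀ (w : Env) (L : ℝ), FlatAt w.1 c ℓ L → ∀ x : ℝ,
      P {ω | ∃ u, L ∈ Set.uIcc x (scaleInv w.1 (scale w.1 x + B u ω)) ∧
        ℓ ≤ |scaleInv w.1 (scale w.1 x + B u ω) - L| ∧
        clock w.1 (drive hB (scale w.1 x) ω) u ≤ t} ≤ ε := by
  obtain ⟨ℓ₀, h⟩ := hB.exists_measure_cross_le hε t c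
  refine ⟨max ℓ₀ 1, by positivity, fun w L hL x => ?_⟩
  refine (measure_mono ?_).trans (h _ (by positivity) (le_max_left _ _) w L hL (scale w.1 x))
  rintro ω ⟨u, h1, h2⟩
  refine ⟨u, ?_, h2⟩
  have hmono := (scale_strictMono w.1).monotone
  have hc : ContinuousOn (fun s => scale w.1 x + B s ω) (Set.Icc 0 u) :=
    (continuous_const.add (hB.cont ω)).continuousOn
  have h0 : scale w.1 x + B 0 ω = scale w.1 x := by rw [hB.zero, add_zero]
  rcases Set.mem_uIcc.1 h1 with ⟨h3, h4⟩ | ⟨h3, h4⟩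
  · have h5 := hmono h4
    rw [scale_scaleInv w.2] at h5
    obtain ⟨s, hs, hs'⟩ := intermediate_value_Icc (bot_le : 0 ≤ u) hc
      (show scale w.1 L ∈ _ from ⟨h0.trans_le (hmono h3), h5⟩)
    exact ⟨s, hs.2, hs'⟩
  · have h5 := hmono h3
    rw [scale_scaleInv w.2] at h5
    obtain ⟨s, hs, hs'⟩ := intermediate_value_Icc' (bot_le : 0 ≤ u) hc
      (show scale w.1 L ∈ _ from ⟨h5, (hmono h4).trans_eq h0.symm⟩)
    exact ⟨s, hs.2, hs'⟩

lemma IsContBrownian.measure_abs_le (hB : IsContBrownian B P) {n : ℕ} (hn : n ≠ 0) (R : ℝ) :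
    P {ω | |B n ω| ≤ R} ≤ ENNReal.ofReal ((√(2 * Real.pi * n))⁻¹) * ENNReal.ofReal (2 * R) := by
  have h1 : P {ω | |B n ω| ≤ R} = gaussianReal 0 n (Set.Icc (-R) R) := by
    rw [← (hB.hasLaw_eval n).map_eq, Measure.map_apply (hB.meas _) measurableSet_Icc]
    congr 1 with ω
    change |B n ω| ≤ R ↔ _
    exact abs_le
  rw [h1, gaussianReal_apply _ (by exact_mod_cast hn)]
  calc _ ≤ ∫⁻ x in Set.Icc (-R) R, ENNReal.ofReal ((√(2 * Real.pi * n))⁻¹) := by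
        refine lintegral_mono fun x => ENNReal.ofReal_le_ofReal ?_
        rw [gaussianPDFReal]
        refine mul_le_of_le_one_right (by positivity) (Real.exp_le_one_iff.2 ?_)
        rw [neg_div]
        exact neg_nonpos.2 (by positivity)
    _ = _ := by simp [two_mul]

lemma IsContBrownian.ae_unbounded (hB : IsContBrownian B P) :
    ∀ᵐ ω ∂P, ∀ R : ℝ, ∃ n : ℕ, R < |B n ω| := by
  have h (R : ℕ) : ∀ᵐ ω ∂P, ∃ n : ℕ, (R : ℝ) < |B n ω| := by
    rw [ae_iff]
    have hlim : Tendsto (fun n : ℕ => ENNReal.ofReal ((√(2 * Real.pi * (n + 1 : ℕ)))⁻¹) *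
        ENNReal.ofReal (2 * R)) atTop (𝓝 0) := by
      rw [← zero_mul (ENNReal.ofReal (2 * R)), ← ENNReal.ofReal_zero]
      refine ENNReal.Tendsto.mul_const (ENNReal.tendsto_ofReal ?_) (Or.inr ENNReal.ofReal_ne_top)
      refine Tendsto.inv_tendsto_atTop (Real.tendsto_sqrt_atTop.comp ?_)
      exact (tendsto_natCast_atTop_atTop.comp (tendsto_add_atTop_nat 1)).const_mul_atTop
        (by positivity)
    refine le_antisymm (ge_of_tendsto' hlim fun n => ?_) bot_le
    refine (measure_mono fun ω hω => ?_).trans (hB.measure_abs_le n.succ_ne_zero R)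
    simp only [not_exists, not_lt, Set.mem_ofPred_eq] at hω ⊢
    exact hω (n + 1)
  filter_upwards [ae_all_iff.2 h] with ω hω R
  obtain ⟨m, hm⟩ := exists_nat_ge R
  obtain ⟨n, hn⟩ := hω m
  exact ⟨n, hm.trans_lt hn⟩

/-- The diffusion does not explode: its clock exceeds every time. -/
lemma IsContBrownian.ae_exists_lt_clock (hB : IsContBrownian B P) {w : Env} (h : GoodRight w.1)
    (h' : GoodRight (reflect w.1)) (t : ℝ≥0) (x : ℝ) :
    ∀ᵐ ω ∂P, ∃ u, (t : ℝ) < clock w.1 (drive hB (scale w.1 x) ω) u := by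
  rw [ae_iff]
  set Z := {ω | ¬∃ u, (t : ℝ) < clock w.1 (drive hB (scale w.1 x) ω) u} with hZ
  by_contra h0
  have := hB.isProbabilityMeasure
  -- On `Z` the unbounded Brownian path leaves through one of two flat intervals while the clock is
  -- still at most `t`. Each way out costs at most `P Z / 4`, so `P Z ≤ P Z / 2`.
  have hε : P Z / 2 / 2 ≠ 0 := by simp [h0]
  obtain ⟨ℓ, hℓ, hpass⟩ := hB.exists_measure_pass_le hε t 1
  obtain ⟨L, hL, hflat⟩ := h.2 ℓ |x|
  obtain ⟨L', hL', hflat'⟩ := h'.2 ℓ |x|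
  have h1 := hpass w L hflat x
  have h2 := hpass w (-L') hflat'.of_reflect x
  have h3 : P Z ≤ P Z / 2 / 2 + P Z / 2 / 2 := by
    refine le_trans (measure_mono_ae ?_) ((measure_union_le _ _).trans (add_le_add h1 h2))
    filter_upwards [hB.ae_unbounded] with ω hω hωZ
    change ¬∃ u, (t : ℝ) < clock w.1 (drive hB (scale w.1 x) ω) u at hωZ
    push Not at hωZ
    have hx := abs_le.1 (le_refl |x|)
    obtain ⟨n, hn⟩ := hω (max (scale w.1 (L + ℓ) - scale w.1 x)
      (scale w.1 x - scale w.1 (-L' - ℓ)))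
    obtain ⟨hn1, hn2⟩ := max_lt_iff.1 hn
    rcases le_total 0 (B n ω) with hpos | hneg
    · rw [abs_of_nonneg hpos] at hn1
      have h4 := (lt_scaleInv_iff w.2 (y := scale w.1 x + B n ω)).2
        (show scale w.1 (L + ℓ) < _ by linarith)
      refine Or.inl ⟨n, Set.mem_uIcc.2 (Or.inl ⟨by linarith, by linarith⟩), ?_, hωZ n⟩
      exact le_trans (by linarith) (le_abs_self _)
    · rw [abs_of_nonpos hneg] at hn2
      have h4 := (scaleInv_lt_iff w.2 (y := scale w.1 x + B n ω)).2
        (show _ < scale w.1 (-L' - ℓ) by linarith)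
      refine Or.inr ⟨n, Set.mem_uIcc.2 (Or.inr ⟨by linarith, by linarith⟩), ?_, hωZ n⟩
      exact le_trans (by linarith) (neg_le_abs _)
  rw [ENNReal.add_halves] at h3
  exact absurd h3 (not_le.2 (ENNReal.half_lt_self h0 (measure_ne_top _ _)))

/-- The constant is `1` for the oscillation of `w` plus `1` for the perturbation at each of `y` and
`L`. -/
lemma FlatAt.eventually {w : Env} {ℓ L : ℝ} (h : FlatAt w.1 1 ℓ L) :
    ∀ᶠ v : Env in 𝓝 w, FlatAt v.1 3 ℓ L := by
  have h1 : ∀ᶠ v : Env in 𝓝 w, ∀ y ∈ Set.Icc (L - |ℓ|) (L + |ℓ|), |v.1 y - w.1 y| < 1 := by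
    refine isCompact_Icc.eventually_forall_of_forall_eventually fun y _ => ?_
    have hc : Continuous fun p : Env × ℝ => |p.1.1 p.2 - w.1 p.2| := by
      have : Continuous fun p : Env × ℝ => p.1.1 p.2 :=
        continuous_eval.comp (f := fun p : Env × ℝ => (p.1.1, p.2)) (by fun_prop)
      fun_prop
    exact (hc.tendsto (w, y)).eventually_lt_const (by simp)
  filter_upwards [h1] with v hv y hy
  have h2 := abs_le.1 hy
  have h3 := abs_lt.1 (hv y ⟨by linarith [le_abs_self ℓ], by linarith [le_abs_self ℓ]⟩)
  have h4 := abs_lt.1 (hv L ⟨by linarith [abs_nonneg ℓ], by linarith [abs_nonneg ℓ]⟩)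
  have h5 := abs_le.1 (h y hy)
  exact abs_le.2 ⟨by linarith, by linarith⟩

/-- Uniformly for environments close to a good one, the diffusion does not come back quickly from
far away. -/
lemma IsContBrownian.exists_measure_path_le (hB : IsContBrownian B P) {w : Env}
    (h : GoodRight w.1) (h' : GoodRight (reflect w.1)) (t : ℝ≥0) (K : ℝ) {ε : ℝ≥0∞}
    (hε : ε ≠ 0) : ∃ M : ℝ, ∀ᶠ v : Env in 𝓝 w, ∀ x, M ≤ |x| →
      P {ω | |path v.1 (drive hB (scale v.1 x) ω) t| ≤ K} ≤ ε := by
  obtain ⟨ℓ, hℓ, hpass⟩ := hB.exists_measure_pass_le hε t 3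
  -- With the centre beyond `K + ℓ`, a path from `x ≥ L` that is in `[-K, K]` at time `t` has passed
  -- `L` and is at distance at least `ℓ` from it.
  obtain ⟨L, hL, hflat⟩ := h.2 ℓ (K + ℓ)
  obtain ⟨L', hL', hflat'⟩ := h'.2 ℓ (K + ℓ)
  refine ⟨max L L', ?_⟩
  filter_upwards [hflat.eventually, hflat'.of_reflect.eventually] with v hv hv' x hx
  obtain ⟨hx1, hx2⟩ := max_le_iff.1 hx
  rcases le_total 0 x with hpos | hneg
  · rw [abs_of_nonneg hpos] at hx1
    refine (measure_mono fun ω hω => ?_).trans (hpass v L hv x)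
    have h1 := abs_le.1 (show |scaleInv v.1 (scale v.1 x + B (clockInv v.1 _ t) ω)| ≤ K from hω)
    exact ⟨_, Set.mem_uIcc.2 (Or.inr ⟨by linarith, hx1⟩),
      le_trans (by linarith) (neg_le_abs _), clock_clockInv_le v _ t⟩
  · rw [abs_of_nonpos hneg] at hx2
    refine (measure_mono fun ω hω => ?_).trans (hpass v (-L') hv' x)
    have h1 := abs_le.1 (show |scaleInv v.1 (scale v.1 x + B (clockInv v.1 _ t) ω)| ≤ K from hω)
    exact ⟨_, Set.mem_uIcc.2 (Or.inl ⟨by linarith, by linarith⟩),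
      le_trans (by linarith) (le_abs_self _), clock_clockInv_le v _ t⟩

lemma abs_le_norm (f : C₀(ℝ, ℝ)) (x : ℝ) : |f x| ≤ ‖f‖ :=
  f.toBCF.norm_coe_le_norm x

lemma semigroup_eq (hB : IsContBrownian B P) (w : C(ℝ, ℝ)) (t : ℝ≥0) (f : C₀(ℝ, ℝ)) (x : ℝ) :
    semigroup P B w t f x = ∫ ω, f (path w (drive hB (scale w x) ω) t) ∂P := rfl

lemma IsContBrownian.exists_abs_semigroup_le (hB : IsContBrownian B P) {w : Env}
    (h : GoodRight w.1) (h' : GoodRight (reflect w.1)) (t : ℝ≥0) (f : C₀(ℝ, ℝ)) {η : ℝ}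
    (hη : 0 < η) : ∃ M : ℝ, ∀ᶠ v : Env in 𝓝 w, ∀ x, M ≤ |x| →
      |semigroup P B v.1 t f x| ≤ 2 * η := by
  have := hB.isProbabilityMeasure
  obtain ⟨K, hK⟩ : ∃ K, ∀ x, K < |x| → |f x| ≤ η := by
    have h1 : ∀ᶠ x in cocompact ℝ, |f x| ≤ η := by
      have := (f.zero_at_infty'.abs).eventually_le_const (u := η) (by simpa using hη)
      exact this
    obtain ⟨K, hK⟩ := Metric.closedBall_compl_subset_of_mem_cocompact h1 0
    exact ⟨K, fun x hx => hK (by simpa using hx)⟩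
  obtain ⟨M, hM⟩ := hB.exists_measure_path_le h h' t K
    -- The part of the expectation from paths inside `[-K, K]` is then at most `η`; the `+ 1` covers
    -- `f = 0`.
    (ε := ENNReal.ofReal (η / (‖f‖ + 1))) (by simp; positivity)
  refine ⟨M, ?_⟩
  filter_upwards [hM] with v hv x hx
  have h1 : P.real {ω | |path v.1 (drive hB (scale v.1 x) ω) t| ≤ K} ≤ η / (‖f‖ + 1) :=
    ENNReal.toReal_le_of_le_ofReal (by positivity) (hv x hx)
  have hm : MeasurableSet {ω | |path v.1 (drive hB (scale v.1 x) ω) t| ≤ K} :=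
    measurableSet_le (measurable_path hB v _ t).abs measurable_const
  set S := {ω | |path v.1 (drive hB (scale v.1 x) ω) t| ≤ K} with hS
  rw [semigroup_eq hB, ← Real.norm_eq_abs]
  calc _ ≤ ∫ ω, (η + S.indicator (fun _ => ‖f‖) ω) ∂P := by
        refine norm_integral_le_of_norm_le
          ((integrable_const _).add ((integrable_const _).indicator hm)) (ae_of_all _ fun ω => ?_)
        by_cases hω : ω ∈ S
        · rw [Set.indicator_of_mem hω]
          exact (abs_le_norm f _).trans (by linarith)
        · rw [Set.indicator_of_notMem hω, add_zero]
          exact hK _ (not_le.1 hω)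
    _ = η + P.real S * ‖f‖ := by
        rw [integral_add (integrable_const _) ((integrable_const _).indicator hm),
          integral_indicator_const _ hm]
        simp
    _ ≤ η + η / (‖f‖ + 1) * (‖f‖ + 1) := by
        gcongr
        linarith
    _ = 2 * η := by
        have : ‖f‖ + 1 ≠ 0 := by positivity
        field_simp
        ring

lemma IsContBrownian.continuousAt_semigroup (hB : IsContBrownian B P) {w : Env}
    (h : GoodRight w.1) (h' : GoodRight (reflect w.1)) (t : ℝ≥0) (f : C₀(ℝ, ℝ)) (x : ℝ) :
    ContinuousAt (fun p : Env × ℝ => semigroup P B p.1.1 t f p.2) (w, x) := by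
  have := hB.isProbabilityMeasure
  have : FirstCountableTopology Env := IsInducing.subtypeVal.firstCountableTopology
  simp only [semigroup_eq hB]
  refine continuousAt_of_dominated (bound := fun _ => ‖f‖) (Eventually.of_forall fun p => ?_)
    (Eventually.of_forall fun p => ae_of_all _ fun ω => abs_le_norm f _) (integrable_const _) ?_
  · exact (f.continuous.measurable.comp (measurable_path hB p.1 _ t)).aestronglyMeasurable
  · filter_upwards [hB.ae_exists_lt_clock h h' t x] with ω ⟨u, hu⟩
    have hd : Continuous fun y => drive hB y ω := by
      refine ContinuousMap.continuous_of_continuous_uncurry _ ?_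
      have := hB.cont ω
      exact (by fun_prop : Continuous fun p : ℝ × ℝ≥0 => p.1 + B p.2 ω)
    have hs : Continuous fun p : Env × ℝ => (p.1, drive hB (scale p.1.1 p.2) ω) :=
      continuous_fst.prodMk (hd.comp (continuous_scale_uncurry.comp
        (by fun_prop : Continuous fun p : Env × ℝ => (p.1.1, p.2))))
    exact f.continuous.continuousAt.comp (ContinuousAt.comp (f := fun p : Env × ℝ =>
      (p.1, drive hB (scale p.1.1 p.2) ω)) (continuousAt_path hu) hs.continuousAt)

lemma IsContBrownian.tendsto_supNorm (hB : IsContBrownian B P) {w : Env}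
    (h : GoodRight w.1) (h' : GoodRight (reflect w.1)) (t : ℝ≥0) (f : C₀(ℝ, ℝ)) :
    Tendsto (fun v : Env => supNorm fun x => semigroup P B v.1 t f x - semigroup P B w.1 t f x)
      (𝓝 w) (𝓝 0) := by
  rw [ENNReal.tendsto_nhds_zero]
  intro ε hε
  obtain ⟨δ, hδ, hδε⟩ := ENNReal.lt_iff_exists_nnreal_btwn.1 hε
  have hδ' : (0 : ℝ) < δ := by exact_mod_cast hδ
  -- Beyond `M` each of the two semigroups is at most `δ / 2`; the bound for `w` itself is the
  -- neighbourhood statement taken at its centre.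
  obtain ⟨M, hM⟩ := hB.exists_abs_semigroup_le h h' t f (η := δ / 4) (by positivity)
  have hcpt : ∀ᶠ v : Env in 𝓝 w, ∀ x ∈ Set.Icc (-M) M,
      |semigroup P B v.1 t f x - semigroup P B w.1 t f x| < δ := by
    refine isCompact_Icc.eventually_forall_of_forall_eventually fun x _ => ?_
    have h1 := hB.continuousAt_semigroup h h' t f x
    have h2 : ContinuousAt (fun p : Env × ℝ => semigroup P B w.1 t f p.2) (w, x) :=
      ContinuousAt.comp (f := fun p : Env × ℝ => (w, p.2)) (x := (w, x)) h1 (by fun_prop)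
    exact (h1.sub h2).abs.eventually_lt_const (by simpa using hδ')
  filter_upwards [hM, hcpt] with v hv1 hv2
  refine (iSup_le fun x => ?_).trans hδε.le
  rw [← ofReal_norm, Real.norm_eq_abs, ← ENNReal.ofReal_coe_nnreal]
  refine ENNReal.ofReal_le_ofReal ?_
  rcases le_total M |x| with hx | hx
  · have h3 := abs_sub (semigroup P B v.1 t f x) (semigroup P B w.1 t f x)
    linarith [hv1 x hx, hM.self_of_nhds x hx]
  · exact (hv2 x (abs_le.1 hx)).le

lemma semigroup_congr {B' : ℝ≥0 → Ω → ℝ} (h : ∀ᵐ ω ∂P, ∀ t, B' t ω = B t ω) :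
    semigroup P B' = semigroup P B := by
  ext w t f x
  refine integral_congr_ae ?_
  filter_upwards [h] with ω hω
  simp only [hω]

end Semigroup

end Brox

/-- For almost every trajectory `w = W(ω)` of a two-sided Brownian motion, whenever environments
`wₙ`, whose scale functions are onto `ℝ`, converge to `w` uniformly on compact sets, the quenched
semigroups satisfy `‖H_t⁽ⁿ⁾ f - H_t f‖ → 0` in the supremum norm for all `t ≥ 0` and `f ∈ C₀`.
The topology of `C(ℝ, ℝ)` is that of uniform convergence on compact sets. -/
theorem mainTheorem5 {Ω Ω' : Type*} [MeasurableSpace Ω] [MeasurableSpace Ω']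
    (μ : Measure Ω) [IsProbabilityMeasure μ] (ν : Measure Ω') [IsProbabilityMeasure ν]
    (W : Ω → C(ℝ, ℝ)) (hW : Brox.IsTwoSidedBrownian W μ)
    (B : ℝ≥0 → Ω' → ℝ) (hB : IsBrownianReal B ν) :
    ∀ᵐ ω ∂μ, ∀ w : ℕ → C(ℝ, ℝ),
      (∀ n, Function.Surjective (Brox.scale (w n))) →
      Tendsto w atTop (𝓝 (W ω)) →
      ∀ (t : ℝ≥0) (f : C₀(ℝ, ℝ)),
        Tendsto (fun n => Brox.supNorm (fun x =>
          Brox.semigroup ν B (w n) t f x - Brox.semigroup ν B (W ω) t f x)) atTop (𝓝 0) := by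
  obtain ⟨V, hV, hVB⟩ := Brox.exists_isContBrownian hB
  filter_upwards [Brox.ae_good hW] with ω ⟨h, h'⟩ w hw hlim t f
  let w₀ : Brox.Env := ⟨W ω, Brox.surjective_scale h h'⟩
  have hlim' : Tendsto (fun n => (⟨w n, hw n⟩ : Brox.Env)) atTop (𝓝 w₀) :=
    tendsto_subtype_rng.2 hlim
  have := (hV.tendsto_supNorm (w := w₀) h h' t f).comp hlim'
  rwa [Brox.semigroup_congr hVB] at this
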